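/- Let $q\in\mathbb{C}$ with $q\neq 0$ and $|q|\neq 1$, and let $C(U_q(2))$ be the universal unital $C^*$-algebra generated by $a,b,D$ subject to $$ba=q\,ab,\quad a^*b=q\,ba^*,\quad bb^*=b^*b,\quad aa^*+bb^*=1,\quad a^*a+|q|^2b^*b=1,$$ $$aD=Da,\quad bD=q^2|q|^{-2}Db,\quad DD^*=D^*D=1.$$ Put $\theta=\frac1\pi\arg(q)$. 1. If $q$ is real, then the center of $C(U_q(2))$ is isomorphic, as a $C^*$-algebra, to $C(\mathbb{T})$, the algebra of continuous complex-valued functions on the unit circle $\mathbb{T}$. 2. If $q$ is not real and $\theta$ is irrational, then the center of $C(U_q(2))$ is trivial: it equals $\mathbb{C}\cdot 1$ and is isomorphic to $\mathbb{C}$. -/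

import Mathlib

open scoped ENNReal

/-- The defining relations of `C(U_q(2))` for three elements `a, b, D` of a unital C*-algebra. -/
structure UqRel (q : ℂ) {B : Type*} [CStarAlgebra B] (a b D : B) : Prop where
  ba : b * a = q • (a * b)
  sa_b : star a * b = q • (b * star a)
  b_normal : b * star b = star b * b
  a_sa : a * star a + b * star b = 1
  aD : a * D = D * a
  bD : b * D = (q ^ 2 * (‖q‖ : ℂ) ^ (-2 : ℤ)) • (D * b)
  D_sD : D * star D = 1
  sD_D : star D * D = 1
  sa_a : star a * a + ((‖q‖ : ℂ) ^ 2) • (star b * b) = 1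

namespace UqRel

variable {q : ℂ} {B : Type*} [CStarAlgebra B] {a b D : B}

theorem norm_a_le [Nontrivial B] (h : UqRel q a b D) : ‖a‖ ≤ 1 := by
  let _ := CStarAlgebra.spectralOrder B
  have _ := CStarAlgebra.spectralOrderedRing B
  have h1 : ‖a * star a‖ ≤ 1 := by
    rw [← norm_one (α := B)]
    refine CStarAlgebra.norm_le_norm_of_nonneg_of_le (mul_star_self_nonneg a) ?_
    rw [← h.a_sa]; exact le_add_of_nonneg_right (mul_star_self_nonneg b)
  rw [CStarRing.norm_self_mul_star] at h1
  nlinarith [norm_nonneg a]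

theorem norm_b_le [Nontrivial B] (h : UqRel q a b D) : ‖b‖ ≤ 1 := by
  let _ := CStarAlgebra.spectralOrder B
  have _ := CStarAlgebra.spectralOrderedRing B
  have h1 : ‖b * star b‖ ≤ 1 := by
    rw [← norm_one (α := B)]
    refine CStarAlgebra.norm_le_norm_of_nonneg_of_le (mul_star_self_nonneg b) ?_
    rw [← h.a_sa]; exact le_add_of_nonneg_left (mul_star_self_nonneg a)
  rw [CStarRing.norm_self_mul_star] at h1
  nlinarith [norm_nonneg b]

theorem norm_D_le [Nontrivial B] (h : UqRel q a b D) : ‖D‖ ≤ 1 := by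
  have h1 : ‖D * star D‖ = 1 := by rw [h.D_sD, norm_one]
  rw [CStarRing.norm_self_mul_star] at h1
  nlinarith [norm_nonneg D]

end UqRel

/-- A triple of elements satisfying the relations, in some nonzero unital C*-algebra in `Type`. A C*-algebra
generated by three elements has at most continuum many points, so it has a copy in `Type`;
`CUq2.existsUnique_hom` below therefore holds for C*-algebras in every universe. -/
structure UqTriple (q : ℂ) : Type 1 where
  carrier : Type
  [cstar : CStarAlgebra carrier]
  [nontriv : Nontrivial carrier]
  a : carrier
  b : carrier
  D : carrier
  rel : UqRel q a b D

attribute [instance] UqTriple.cstar UqTriple.nontriv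

noncomputable section

/-- The C*-algebra of all bounded families indexed by the triples satisfying the relations. -/
abbrev UqProd (q : ℂ) : Type 1 := lp (fun t : UqTriple q => t.carrier) ∞

instance UqProd.instCStarAlgebra (q : ℂ) : CStarAlgebra (UqProd q) where

namespace UqProd

/-- The tautological family of the elements `a`. -/
def a (q : ℂ) : UqProd q :=
  ⟨fun t => t.a, memℓp_infty ⟨1, by rintro _ ⟨t, rfl⟩; exact t.rel.norm_a_le⟩⟩

/-- The tautological family of the elements `b`. -/
def b (q : ℂ) : UqProd q :=
  ⟨fun t => t.b, memℓp_infty ⟨1, by rintro _ ⟨t, rfl⟩; exact t.rel.norm_b_le⟩⟩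

/-- The tautological family of the elements `D`. -/
def D (q : ℂ) : UqProd q :=
  ⟨fun t => t.D, memℓp_infty ⟨1, by rintro _ ⟨t, rfl⟩; exact t.rel.norm_D_le⟩⟩

end UqProd

/-- The closed unital star subalgebra generated by the three tautological families. -/
def CUq2.subalgebra (q : ℂ) : StarSubalgebra ℂ (UqProd q) :=
  (StarAlgebra.adjoin ℂ {UqProd.a q, UqProd.b q, UqProd.D q}).topologicalClosure

/-- The universal unital C*-algebra `C(U_q(2))` generated by `a, b, D` subject to the relations:
`CUq2.rel` says that the generators satisfy them, `CUq2.existsUnique_hom` is the universal property. -/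
def CUq2 (q : ℂ) : Type 1 := CUq2.subalgebra q

namespace CUq2

variable (q : ℂ)

instance : IsClosed (subalgebra q : Set (UqProd q)) :=
  StarSubalgebra.isClosed_topologicalClosure _

instance instCStarAlgebra : CStarAlgebra (CUq2 q) :=
  inferInstanceAs (CStarAlgebra (subalgebra q))

theorem gen_mem {x : UqProd q} (hx : x ∈ ({UqProd.a q, UqProd.b q, UqProd.D q} : Set (UqProd q))) :
    x ∈ subalgebra q :=
  StarSubalgebra.le_topologicalClosure _ (StarAlgebra.subset_adjoin ℂ _ hx)

/-- The generator `a` of `C(U_q(2))`. -/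
def a : CUq2 q := ⟨UqProd.a q, gen_mem q (by simp)⟩

/-- The generator `b` of `C(U_q(2))`. -/
def b : CUq2 q := ⟨UqProd.b q, gen_mem q (by simp)⟩

/-- The generator `D` of `C(U_q(2))`. -/
def D : CUq2 q := ⟨UqProd.D q, gen_mem q (by simp)⟩

/-- The unital star homomorphism from `C(U_q(2))` given by a triple satisfying the relations. -/
def eval (t : UqTriple q) : CUq2 q →⋆ₐ[ℂ] t.carrier where
  toFun x := (x.1 : ∀ t : UqTriple q, t.carrier) t
  map_one' := rfl
  map_mul' _ _ := rfl
  map_zero' := rfl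
  map_add' _ _ := rfl
  commutes' _ := rfl
  map_star' _ := rfl

theorem ext_eval {x y : CUq2 q} (h : ∀ t, eval q t x = eval q t y) : x = y :=
  Subtype.ext (Subtype.ext (funext h))

theorem rel : UqRel q (a q) (b q) (D q) where
  ba := ext_eval q fun t => by simp only [map_mul, map_smul]; exact t.rel.ba
  sa_b := ext_eval q fun t => by simp only [map_mul, map_smul, map_star]; exact t.rel.sa_b
  b_normal := ext_eval q fun t => by simp only [map_mul, map_star]; exact t.rel.b_normal
  a_sa := ext_eval q fun t => by simp only [map_mul, map_add, map_star, map_one]; exact t.rel.a_sa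
  aD := ext_eval q fun t => by simp only [map_mul]; exact t.rel.aD
  bD := ext_eval q fun t => by simp only [map_mul, map_smul]; exact t.rel.bD
  D_sD := ext_eval q fun t => by simp only [map_mul, map_star, map_one]; exact t.rel.D_sD
  sD_D := ext_eval q fun t => by simp only [map_mul, map_star, map_one]; exact t.rel.sD_D
  sa_a := ext_eval q fun t => by
    simp only [map_mul, map_smul, map_add, map_star, map_one]; exact t.rel.sa_a

variable {q}

theorem hom_ext {B : Type*} [CStarAlgebra B] {φ ψ : CUq2 q →⋆ₐ[ℂ] B}
    (ha : φ (a q) = ψ (a q)) (hb : φ (b q) = ψ (b q)) (hD : φ (D q) = ψ (D q)) : φ = ψ := by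
  have hφ : Continuous φ := AddMonoidHomClass.continuous_of_bound φ 1 fun x => by
    simpa using NonUnitalStarAlgHom.norm_apply_le φ x
  have hψ : Continuous ψ := AddMonoidHomClass.continuous_of_bound ψ 1 fun x => by
    simpa using NonUnitalStarAlgHom.norm_apply_le ψ x
  refine StarAlgHom.ext_topologicalClosure (R := ℂ) (A := UqProd q) (B := B)
    (S := StarAlgebra.adjoin ℂ {UqProd.a q, UqProd.b q, UqProd.D q})
    (φ := φ) (ψ := ψ) hφ hψ ?_
  refine StarAlgHom.ext_adjoin ?_
  rintro ⟨x, hx⟩ (rfl | rfl | rfl)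
  · exact ha
  · exact hb
  · exact hD

end CUq2

theorem small_closure_adjoin {B : Type*} [CStarAlgebra B] (s : Set B) [Small.{0} s] :
    Small.{0} (StarAlgebra.adjoin ℂ s).topologicalClosure := by
  have h1 : Small.{0} (StarAlgebra.adjoin ℂ s) := by
    have : Small.{0} (star s : Set B) := by rw [← Set.image_star]; infer_instance
    let e := equivShrink.{0} (s ∪ star s : Set B)
    let f : FreeAlgebra ℂ (Shrink.{0} (s ∪ star s : Set B)) →ₐ[ℂ] B :=
      FreeAlgebra.lift ℂ fun x => (e.symm x : B)
    have hr : (StarAlgebra.adjoin ℂ s : Set B) ⊆ Set.range f := by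
      intro x hx
      change x ∈ f.range
      have : (Algebra.adjoin ℂ (s ∪ star s)) ≤ f.range := by
        refine Algebra.adjoin_le fun y hy => ⟨FreeAlgebra.ι ℂ (e ⟨y, hy⟩), ?_⟩
        simp [f]
      exact this hx
    exact small_subset hr
  have hr : ((StarAlgebra.adjoin ℂ s).topologicalClosure : Set B) ⊆
      Set.range fun u : ℕ → StarAlgebra.adjoin ℂ s =>
        Filter.limUnder Filter.atTop fun n => (u n : B) := by
    intro x hx
    obtain ⟨u, hu, hux⟩ := mem_closure_iff_seq_limit.mp hx
    exact ⟨fun n => ⟨u n, hu n⟩, hux.limUnder_eq⟩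
  exact small_subset hr

theorem exists_small_copy (C : Type*) [CStarAlgebra C] [Small.{0} C] :
    ∃ (C₀ : Type) (_ : CStarAlgebra C₀), Nonempty (C₀ ≃⋆ₐ[ℂ] C) := by
  let e : Shrink.{0} C ≃ C := (equivShrink C).symm
  let i1 : NormedRing (Shrink.{0} C) := e.normedRing
  let i2 : StarRing (Shrink.{0} C) := e.starRing
  let i3 : Algebra ℂ (Shrink.{0} C) := e.algebra ℂ
  let E : Shrink.{0} C ≃⋆ₐ[ℂ] C :=
    { e with
      map_mul' := fun x y => e.apply_symm_apply _
      map_add' := fun x y => e.apply_symm_apply _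
      map_star' := fun x => e.apply_symm_apply _
      map_smul' := fun c x => e.apply_symm_apply _ }
  have hE : Isometry E := fun _ _ => rfl
  have hc : CompleteSpace (Shrink.{0} C) :=
    (hE.isUniformInducing.completeSpace_congr E.surjective).2 inferInstance
  have hn : ∀ x : Shrink.{0} C, ‖x‖ = ‖E x‖ := fun _ => rfl
  refine ⟨Shrink.{0} C,
    { i1, i2 with
      complete := hc.complete
      norm_mul_self_le := fun x => ?_
      toAlgebra := i3
      norm_smul_le := fun c x => ?_
      star_smul := fun c x => ?_ }, ⟨E⟩⟩
  · rw [hn, hn, map_mul, map_star]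
    exact CStarRing.norm_mul_self_le _
  · rw [hn, hn, map_smul]; exact norm_smul_le _ _
  · apply E.injective
    change E (star (c • x)) = E (star c • star x)
    rw [map_star, map_smul, star_smul, map_smul, map_star]

namespace CUq2

variable {q : ℂ}

/-- The universal property of `C(U_q(2))`, for unital C*-algebras in an arbitrary universe. -/
theorem existsUnique_hom {B : Type*} [CStarAlgebra B] {x y z : B} (h : UqRel q x y z) :
    ∃! φ : CUq2 q →⋆ₐ[ℂ] B, φ (a q) = x ∧ φ (b q) = y ∧ φ (D q) = z := by
  refine existsUnique_of_exists_of_unique ?_ fun φ ψ hφ hψ => hom_ext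
    (hφ.1.trans hψ.1.symm) (hφ.2.1.trans hψ.2.1.symm) (hφ.2.2.trans hψ.2.2.symm)
  rcases subsingleton_or_nontrivial B with hB | hB
  · exact ⟨{ toFun := fun _ => 0, map_one' := Subsingleton.elim _ _,
             map_mul' := fun _ _ => Subsingleton.elim _ _, map_zero' := rfl,
             map_add' := fun _ _ => Subsingleton.elim _ _,
             commutes' := fun _ => Subsingleton.elim _ _,
             map_star' := fun _ => Subsingleton.elim _ _ },
      Subsingleton.elim _ _, Subsingleton.elim _ _, Subsingleton.elim _ _⟩
  let S := (StarAlgebra.adjoin ℂ ({x, y, z} : Set B)).topologicalClosure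
  have hS : IsClosed (S : Set B) := StarSubalgebra.isClosed_topologicalClosure _
  have hmem : ∀ w ∈ ({x, y, z} : Set B), w ∈ S := fun w hw =>
    StarSubalgebra.le_topologicalClosure _ (StarAlgebra.subset_adjoin ℂ _ hw)
  have : Small.{0} S := small_closure_adjoin _
  obtain ⟨C, _, ⟨E⟩⟩ := exists_small_copy S
  let F : C →⋆ₐ[ℂ] B := S.subtype.comp (E : C →⋆ₐ[ℂ] S)
  have hF : Function.Injective F := Subtype.val_injective.comp E.injective
  have : Nontrivial C := E.toEquiv.nontrivial
  have key : ∀ w (hw : w ∈ S), F (E.symm ⟨w, hw⟩) = w := fun w hw => by simp [F]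
  let t : UqTriple q :=
    { carrier := C
      a := E.symm ⟨x, hmem x (by simp)⟩
      b := E.symm ⟨y, hmem y (by simp)⟩
      D := E.symm ⟨z, hmem z (by simp)⟩
      rel := by
        constructor <;> apply hF <;>
          simp only [map_mul, map_add, map_smul, map_star, map_one, key]
        exacts [h.ba, h.sa_b, h.b_normal, h.a_sa, h.aD, h.bD, h.D_sD, h.sD_D, h.sa_a] }
  exact ⟨F.comp (eval q t), key x _, key y _, key z _⟩

end CUq2

end

/-!
The argument stays inside `C(U_q(2))` and needs no faithful representation. Sending `a, b, D` to
`a*, |q| b, D*` identifies `C(U_q(2))` with `C(U_{q⁻¹}(2))`, so let `|q| < 1`, and put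
`ω = q² / |q|²`, so that `b D = ω D b`.

*Fourier decomposition.* By the universal property the torus `𝕋³` acts on `C(U_q(2))` by rescaling
the generators. This gives projections `degProj q k l n` onto the elements of degree `k, l, n` in
`a, b, D`, which preserve the center. An element whose homogeneous parts all lie in a closed
subspace lies in it too (`mem_of_degProj_mem`). Words in the generators are homogeneous and
span a dense subspace, so a linear closed property of the homogeneous elements can be tested on
words (`degProj_mem`).

*The ideal of `b`.* Let `powNull a` consist of the `y` with `y aᵐ → 0`. It contains `b` and `b*`,
as `b aᵐ = qᵐ aᵐ b`. Modulo `powNull a` the element `a` is unitary and commutes with `D`. Hence words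
of nonzero degree in `b` lie in `powNull a`, and words of degree `0, 0, n` are scalar multiples of
`Dⁿ` modulo it. But `powNull a` has no nonzero central element
(`UqRel.eq_zero_of_mem_powNull`): from `a* a = 1 - |q|² b* b` one gets
`‖aᵐ⁺¹ x‖ ≥ (1 - |q|²ᵐ⁺²) ‖aᵐ x‖` for central `x`, and the product of these factors is positive.

*Homogeneous central elements.* Let `y` be central of degree `k, l, n`. If `l ≠ 0`, then `y` lies in
`powNull a`, so `y = 0`. In general `b y = qᵏ ωⁿ y b`. If the scalar is not `1`, then
`b y = 0`, while `y* y` is central of degree zero, hence a scalar `c` with `c b = 0`. As `b ≠ 0`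
by a representation on `ℓ²(ℕ × ℤ)`, this gives `y = 0`. The case `l = 0`, `qᵏ ωⁿ = 1` is left, where
`k = 0` because `|q| ≠ 1`. If `q` is real, `D` is central and `y` is a multiple of `Dⁿ`, so the center
is the C*-algebra generated by the unitary `D`, whose spectrum is the whole circle. If
`arg q / π` is irrational, then `n = 0` and `y` is a scalar.
-/

open Filter Topology

/-! ### The phase and the words in the generators -/

/-- The phase `q² / |q|²` in the relation `b D = q² |q|⁻² D b`. -/
noncomputable def uqPhase (q : ℂ) : ℂ := q ^ 2 * (‖q‖ : ℂ) ^ (-2 : ℤ)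

theorem norm_uqPhase {q : ℂ} (hq : q ≠ 0) : ‖uqPhase q‖ = 1 := by
  have : ‖q‖ ≠ 0 := norm_ne_zero_iff.2 hq
  rw [uqPhase, norm_mul, norm_zpow, norm_pow, Complex.norm_real, norm_norm, zpow_neg]
  exact mul_inv_cancel₀ (pow_ne_zero 2 this)

theorem uqPhase_ne_zero {q : ℂ} (hq : q ≠ 0) : uqPhase q ≠ 0 :=
  norm_ne_zero_iff.1 (by rw [norm_uqPhase hq]; exact one_ne_zero)

theorem uqPhase_inv (q : ℂ) : uqPhase q⁻¹ = (uqPhase q)⁻¹ := by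
  simp [uqPhase, mul_comm]

/-- The words in `a, b, D` and their adjoints, indexed by their degrees in `a`, `b` and `D`,
where the adjoint of a generator has degree `-1`. -/
inductive UqWord {B : Type*} [Monoid B] [Star B] (a b D : B) : ℤ → ℤ → ℤ → B → Prop
  | one : UqWord a b D 0 0 0 1
  | a_mul {k l n : ℤ} {w : B} : UqWord a b D k l n w → UqWord a b D (1 + k) l n (a * w)
  | star_a_mul {k l n : ℤ} {w : B} :
      UqWord a b D k l n w → UqWord a b D (-1 + k) l n (star a * w)
  | b_mul {k l n : ℤ} {w : B} : UqWord a b D k l n w → UqWord a b D k (1 + l) n (b * w)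
  | star_b_mul {k l n : ℤ} {w : B} :
      UqWord a b D k l n w → UqWord a b D k (-1 + l) n (star b * w)
  | D_mul {k l n : ℤ} {w : B} : UqWord a b D k l n w → UqWord a b D k l (1 + n) (D * w)
  | star_D_mul {k l n : ℤ} {w : B} :
      UqWord a b D k l n w → UqWord a b D k l (-1 + n) (star D * w)

theorem UqWord.commute {B : Type*} [Monoid B] [Star B] {a b D x : B} (ha : Commute a x)
    (ha' : Commute (star a) x) (hb : Commute b x) (hb' : Commute (star b) x)
    (hD : Commute D x) (hD' : Commute (star D) x) {k l n : ℤ} {w : B}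
    (hw : UqWord a b D k l n w) : Commute w x := by
  induction hw with
  | one => exact Commute.one_left x
  | a_mul _ ih => exact ha.mul_left ih
  | star_a_mul _ ih => exact ha'.mul_left ih
  | b_mul _ ih => exact hb.mul_left ih
  | star_b_mul _ ih => exact hb'.mul_left ih
  | D_mul _ ih => exact hD.mul_left ih
  | star_D_mul _ ih => exact hD'.mul_left ih

theorem UqWord.mem_span {B : Type*} [CStarAlgebra B] {a b D x : B}
    (hx : x ∈ StarAlgebra.adjoin ℂ ({a, b, D} : Set B)) :
    x ∈ Submodule.span ℂ {w | ∃ k l n, UqWord a b D k l n w} := by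
  have h1 : x ∈ Subalgebra.toSubmodule
      (Algebra.adjoin ℂ (({a, b, D} : Set B) ∪ star ({a, b, D} : Set B))) := hx
  rw [Algebra.adjoin_eq_span] at h1
  refine Submodule.span_mono (fun w hw => ?_) h1
  induction hw using Submonoid.closure_induction_left with
  | one => exact ⟨0, 0, 0, .one⟩
  | mul_left g hg w _ ih =>
    obtain ⟨k, l, n, ih⟩ := ih
    rcases hg with (rfl | rfl | rfl) | hg
    · exact ⟨_, _, _, ih.a_mul⟩
    · exact ⟨_, _, _, ih.b_mul⟩
    · exact ⟨_, _, _, ih.D_mul⟩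
    · rw [Set.mem_star] at hg
      rcases hg with hg | hg | hg <;> obtain rfl := star_eq_iff_star_eq.1 hg
      · exact ⟨_, _, _, ih.star_a_mul⟩
      · exact ⟨_, _, _, ih.star_b_mul⟩
      · exact ⟨_, _, _, ih.star_D_mul⟩

/-! ### The ideal of the `y` with `y aᵐ → 0` -/

/-- The elements `y` with `y aᵐ → 0`. In `C(U_q(2))` with `|q| < 1` this is the kernel of the
quotient map `b ↦ 0`. -/
def powNull {B : Type*} [CStarAlgebra B] (a : B) : Submodule ℂ B where
  carrier := {y | Tendsto (fun m : ℕ => y * a ^ m) atTop (𝓝 0)}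
  zero_mem' := by simp
  add_mem' {x y} hx hy := by
    have := Tendsto.add hx hy
    simpa only [Set.mem_ofPred_eq, add_mul, add_zero] using this
  smul_mem' c x hx := by
    have := Tendsto.const_smul hx c
    simpa only [Set.mem_ofPred_eq, smul_mul_assoc, smul_zero] using this

section powNull

variable {B : Type*} [CStarAlgebra B] {a y : B}

theorem mem_powNull : y ∈ powNull a ↔ Tendsto (fun m : ℕ => y * a ^ m) atTop (𝓝 0) := Iff.rfl

theorem mul_mem_powNull (x : B) (hy : y ∈ powNull a) : x * y ∈ powNull a := by
  have := Tendsto.const_mul x (mem_powNull.1 hy)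
  simpa only [mem_powNull, mul_assoc, mul_zero] using this

theorem mul_mem_powNull_of_commute {x : B} (hx : Commute x a) (hy : y ∈ powNull a) :
    y * x ∈ powNull a := by
  have := Tendsto.mul_const x (mem_powNull.1 hy)
  simpa only [mem_powNull, mul_assoc, (hx.pow_right _).eq, zero_mul] using this

theorem mem_powNull_of_mul_pow_mem (p : ℕ) (hy : y * a ^ p ∈ powNull a) : y ∈ powNull a := by
  refine (tendsto_add_atTop_iff_nat p).1 ?_
  simpa only [mem_powNull, mul_assoc, ← pow_add, add_comm] using hy

theorem isClosed_powNull (ha : ‖a‖ ≤ 1) : IsClosed (powNull a : Set B) := by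
  have hpow : ∀ m, ‖a ^ m‖ ≤ max 1 ‖(1 : B)‖ := fun m => by
    rcases m with _ | m
    · simp
    · exact (norm_pow_le' a m.succ_pos).trans ((pow_le_one₀ (norm_nonneg _) ha).trans
        (le_max_left _ _))
  set C := max 1 ‖(1 : B)‖
  have hC : 0 < C := lt_of_lt_of_le one_pos (le_max_left _ _)
  refine isClosed_of_closure_subset fun y hy => ?_
  rw [SetLike.mem_coe, mem_powNull, Metric.tendsto_atTop]
  intro ε hε
  obtain ⟨z, hz, hyz⟩ := Metric.mem_closure_iff.1 hy (ε / (2 * C)) (by positivity)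
  obtain ⟨M, hM⟩ := Metric.tendsto_atTop.1 (mem_powNull.1 hz) (ε / 2) (by positivity)
  refine ⟨M, fun m hm => ?_⟩
  have h1 := hM m hm
  rw [dist_zero_right] at h1 ⊢
  rw [dist_eq_norm, lt_div_iff₀ (by positivity)] at hyz
  have h2 : ‖y * a ^ m‖ ≤ ‖y - z‖ * C + ‖z * a ^ m‖ := by
    rw [← sub_add_cancel (y * a ^ m) (z * a ^ m), ← sub_mul]
    refine (norm_add_le _ _).trans (add_le_add_left ((norm_mul_le _ _).trans ?_) _)
    exact mul_le_mul_of_nonneg_left (hpow m) (norm_nonneg _)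
  linarith

end powNull

/-! ### Consequences of the relations -/

namespace UqRel

variable {q : ℂ} {B : Type*} [CStarAlgebra B] {a b D : B}

theorem b_mul_D (h : UqRel q a b D) : b * D = uqPhase q • (D * b) := h.bD

theorem b_mul_star_a (h : UqRel q a b D) (hq : q ≠ 0) :
    b * star a = q⁻¹ • (star a * b) := by
  rw [h.sa_b, smul_smul, inv_mul_cancel₀ hq, one_smul]

theorem star_b_mul_a (h : UqRel q a b D) : star b * a = star q • (a * star b) := by
  simpa using congrArg star h.sa_b

theorem star_b_mul_star_a (h : UqRel q a b D) (hq : q ≠ 0) :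
    star b * star a = (star q)⁻¹ • (star a * star b) := by
  have h1 : star a * star b = star q • (star b * star a) := by simpa using congrArg star h.ba
  rw [h1, smul_smul, inv_mul_cancel₀ (star_ne_zero.2 hq), one_smul]

theorem star_D_mul_b (h : UqRel q a b D) : star D * b = uqPhase q • (b * star D) := by
  have h1 : star D * (b * D) * star D = star D * (uqPhase q • (D * b)) * star D := by
    rw [h.b_mul_D]
  rwa [mul_smul_comm, smul_mul_assoc, ← mul_assoc (star D) D b, h.sD_D, one_mul, ← mul_assoc,
    mul_assoc, h.D_sD, mul_one] at h1

theorem b_mul_star_D (h : UqRel q a b D) (hq : q ≠ 0) :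
    b * star D = (uqPhase q)⁻¹ • (star D * b) := by
  rw [h.star_D_mul_b, smul_smul, inv_mul_cancel₀ (uqPhase_ne_zero hq), one_smul]

theorem star_b_mul_D (h : UqRel q a b D) : star b * D = star (uqPhase q) • (D * star b) := by
  simpa using congrArg star h.star_D_mul_b

theorem star_b_mul_star_D (h : UqRel q a b D) (hq : q ≠ 0) :
    star b * star D = (star (uqPhase q))⁻¹ • (star D * star b) := by
  have h1 : star D * star b = star (uqPhase q) • (star b * star D) := by
    simpa using congrArg star h.b_mul_D
  rw [h1, smul_smul, inv_mul_cancel₀ (star_ne_zero.2 (uqPhase_ne_zero hq)), one_smul]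

/-- `D` as an element of the unitary group, so that it has integer powers. -/
def unitaryD (h : UqRel q a b D) : unitary B := ⟨D, h.sD_D, h.D_sD⟩

theorem commute_a_star_D (h : UqRel q a b D) : Commute a (star D) := by
  have h1 : star D * (a * D) * star D = star D * (D * a) * star D := by rw [h.aD]
  rw [← mul_assoc (star D) D a, h.sD_D, one_mul, ← mul_assoc, mul_assoc, h.D_sD, mul_one] at h1
  exact h1.symm

theorem commute_unitaryD_zpow {x : B} (h : UqRel q a b D) (h1 : Commute x D)
    (h2 : Commute x (star D)) (n : ℤ) : Commute ((h.unitaryD ^ n : unitary B) : B) x := by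
  induction n with
  | zero => simp
  | succ n ih =>
    rw [zpow_add_one, Submonoid.coe_mul]
    exact ih.mul_left h1.symm
  | pred n ih =>
    rw [zpow_sub_one, Submonoid.coe_mul]
    exact ih.mul_left h2.symm

/-- A word is an eigenvector for commutation with `b`. -/
theorem b_mul_word (h : UqRel q a b D) (hq : q ≠ 0) {k l n : ℤ} {w : B}
    (hw : UqWord a b D k l n w) : b * w = (q ^ k * uqPhase q ^ n) • (w * b) := by
  have hω := uqPhase_ne_zero hq
  induction hw with
  | one => simp
  | a_mul _ ih =>
    rw [← mul_assoc, h.ba, smul_mul_assoc, mul_assoc, ih, mul_smul_comm, smul_smul, mul_assoc a,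
      zpow_add₀ hq, zpow_one, mul_assoc]
  | star_a_mul _ ih =>
    rw [← mul_assoc, h.b_mul_star_a hq, smul_mul_assoc, mul_assoc, ih, mul_smul_comm, smul_smul,
      mul_assoc (star a), zpow_add₀ hq, zpow_neg_one, mul_assoc]
  | b_mul _ ih => rw [mul_assoc b, ← mul_smul_comm, ← ih]
  | star_b_mul _ ih =>
    rw [← mul_assoc, h.b_normal, mul_assoc, ih, mul_smul_comm, mul_assoc]
  | D_mul _ ih =>
    rw [← mul_assoc, h.b_mul_D, smul_mul_assoc, mul_assoc, ih, mul_smul_comm, smul_smul,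
      mul_assoc D, zpow_add₀ hω, zpow_one, mul_left_comm]
  | star_D_mul _ ih =>
    rw [← mul_assoc, h.b_mul_star_D hq, smul_mul_assoc, mul_assoc, ih, mul_smul_comm, smul_smul,
      mul_assoc (star D), zpow_add₀ hω, zpow_neg_one, mul_left_comm]

theorem exists_star_b_mul_word (h : UqRel q a b D) (hq : q ≠ 0) {k l n : ℤ} {w : B}
    (hw : UqWord a b D k l n w) : ∃ c : ℂ, star b * w = c • (w * star b) := by
  have key : ∀ {g w : B} {c : ℂ}, star b * g = c • (g * star b) →
      (∃ c : ℂ, star b * w = c • (w * star b)) →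
      ∃ c : ℂ, star b * (g * w) = c • (g * w * star b) := by
    rintro g w c hg ⟨c', hw⟩
    exact ⟨c * c', by rw [← mul_assoc, hg, smul_mul_assoc, mul_assoc, hw, mul_smul_comm, smul_smul,
      mul_assoc g]⟩
  induction hw with
  | one => exact ⟨1, by simp⟩
  | a_mul _ ih => exact key h.star_b_mul_a ih
  | star_a_mul _ ih => exact key (h.star_b_mul_star_a hq) ih
  | b_mul _ ih => exact key (c := 1) (by rw [one_smul, h.b_normal]) ih
  | star_b_mul _ ih => exact key (c := 1) (by rw [one_smul]) ih
  | D_mul _ ih => exact key h.star_b_mul_D ih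
  | star_D_mul _ ih => exact key (h.star_b_mul_star_D hq) ih

theorem b_mul_pow (h : UqRel q a b D) (m : ℕ) : b * a ^ m = q ^ m • (a ^ m * b) := by
  induction m with
  | zero => simp
  | succ m ih =>
    rw [pow_succ, ← mul_assoc, ih, smul_mul_assoc, mul_assoc, h.ba, mul_smul_comm, smul_smul,
      ← pow_succ, mul_assoc]

theorem norm_a_le_one (h : UqRel q a b D) : ‖a‖ ≤ 1 := by
  rcases subsingleton_or_nontrivial B with _ | _
  · rw [Subsingleton.elim a 0, norm_zero]; exact zero_le_one
  · exact h.norm_a_le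

theorem norm_b_le_one (h : UqRel q a b D) : ‖b‖ ≤ 1 := by
  rcases subsingleton_or_nontrivial B with _ | _
  · rw [Subsingleton.elim b 0, norm_zero]; exact zero_le_one
  · exact h.norm_b_le

theorem norm_a_pow_le (h : UqRel q a b D) (m : ℕ) (x : B) : ‖a ^ m * x‖ ≤ ‖x‖ := by
  induction m with
  | zero => simp
  | succ m ih =>
    rw [pow_succ', mul_assoc]
    refine (norm_mul_le _ _).trans ((mul_le_mul h.norm_a_le_one ih (norm_nonneg _)
      zero_le_one).trans_eq (one_mul _))

theorem b_mem_powNull (h : UqRel q a b D) (hq : ‖q‖ < 1) : b ∈ powNull a := by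
  refine squeeze_zero_norm (a := fun m => ‖q‖ ^ m) (fun m => ?_)
    (tendsto_pow_atTop_nhds_zero_of_lt_one (norm_nonneg q) hq)
  rw [h.b_mul_pow, norm_smul, norm_pow]
  exact mul_le_of_le_one_right (by positivity) ((h.norm_a_pow_le m b).trans h.norm_b_le_one)

theorem star_b_mem_powNull (h : UqRel q a b D) (hq : ‖q‖ < 1) : star b ∈ powNull a := by
  refine squeeze_zero_norm (a := fun m => ‖q‖ ^ m) (fun m => ?_)
    (tendsto_pow_atTop_nhds_zero_of_lt_one (norm_nonneg q) hq)
  have h1 : ∀ m : ℕ, star b * a ^ m = star q ^ m • (a ^ m * star b) := fun m => by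
    induction m with
    | zero => simp
    | succ m ih =>
      rw [pow_succ, ← mul_assoc, ih, smul_mul_assoc, mul_assoc, h.star_b_mul_a, mul_smul_comm,
        smul_smul, ← pow_succ, mul_assoc]
  rw [h1, norm_smul, norm_pow, norm_star]
  exact mul_le_of_le_one_right (by positivity)
    ((h.norm_a_pow_le m _).trans ((norm_star b).trans_le h.norm_b_le_one))

/-- Modulo `powNull a`, a word containing `b` or `b*` vanishes, and any other word becomes
`a^k D^n` after multiplication on the right by a power of `a`. -/
theorem word_mem_powNull_or (h : UqRel q a b D) (hq0 : q ≠ 0) (hq : ‖q‖ < 1) {k l n : ℤ} {w : B}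
    (hw : UqWord a b D k l n w) :
    w ∈ powNull a ∨ (l = 0 ∧ ∃ p p' : ℕ, (p' : ℤ) = p + k ∧
      w * a ^ p - a ^ p' * ((h.unitaryD ^ n : unitary B) : B) ∈ powNull a) := by
  have hDa : ∀ n : ℤ, Commute ((h.unitaryD ^ n : unitary B) : B) a :=
    h.commute_unitaryD_zpow h.aD h.commute_a_star_D
  induction hw with
  | one => exact .inr ⟨rfl, 0, 0, rfl, by simp⟩
  | @a_mul k l n w _ ih =>
    obtain ih | ⟨hl, p, p', hp, ih⟩ := ih
    · exact .inl (mul_mem_powNull _ ih)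
    · refine .inr ⟨hl, p, p' + 1, by push_cast; omega, ?_⟩
      have := mul_mem_powNull a ih
      rwa [mul_sub, ← mul_assoc, ← mul_assoc, ← pow_succ'] at this
  | @star_a_mul k l n w _ ih =>
    obtain ih | ⟨hl, p, p', hp, ih⟩ := ih
    · exact .inl (mul_mem_powNull _ ih)
    · refine .inr ⟨hl, p + 1, p', by push_cast; omega, ?_⟩
      -- `a* a^{p'+1} = a^{p'} - |q|² b* b a^{p'}`, and the last term lies in `powNull a`
      have h1 := mul_mem_powNull (star a) (mul_mem_powNull_of_commute (Commute.refl a) ih)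
      have h2 : star b * b * (a ^ p' * ((h.unitaryD ^ n : unitary B) : B)) ∈ powNull a := by
        rw [mul_assoc, ← mul_assoc b]
        exact mul_mem_powNull _ (mul_mem_powNull_of_commute (hDa n)
          (mul_mem_powNull_of_commute ((Commute.refl a).pow_left p') (h.b_mem_powNull hq)))
      have h3 : star a * a = 1 - ((‖q‖ : ℂ) ^ 2) • (star b * b) := eq_sub_of_add_eq h.sa_a
      have h4 := Submodule.sub_mem _ h1 (Submodule.smul_mem _ ((‖q‖ : ℂ) ^ 2) h2)
      convert h4 using 1
      have h5 : a ^ p' * ((h.unitaryD ^ n : unitary B) : B) * a =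
          a * (a ^ p' * ((h.unitaryD ^ n : unitary B) : B)) := by
        rw [mul_assoc, (hDa n).eq, ← mul_assoc, ← mul_assoc, pow_mul_comm']
      rw [sub_mul, h5, mul_sub, ← mul_assoc (star a) a, h3, sub_mul, one_mul, smul_mul_assoc,
        pow_succ]
      simp only [mul_assoc]
      abel
  | @b_mul k l n w hw ih =>
    left
    rw [h.b_mul_word hq0 hw]
    exact Submodule.smul_mem _ _ (mul_mem_powNull _ (h.b_mem_powNull hq))
  | @star_b_mul k l n w hw ih =>
    left
    obtain ⟨c, hc⟩ := h.exists_star_b_mul_word hq0 hw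
    rw [hc]
    exact Submodule.smul_mem _ _ (mul_mem_powNull _ (h.star_b_mem_powNull hq))
  | @D_mul k l n w _ ih =>
    obtain ih | ⟨hl, p, p', hp, ih⟩ := ih
    · exact .inl (mul_mem_powNull _ ih)
    · refine .inr ⟨hl, p, p', hp, ?_⟩
      have := mul_mem_powNull D ih
      have h7 : D * ((h.unitaryD ^ n : unitary B) : B) = (h.unitaryD ^ (1 + n) : unitary B) := by
        rw [zpow_one_add]; rfl
      rwa [mul_sub, ← mul_assoc, ← mul_assoc, ((show Commute D a from h.aD.symm).pow_right p').eq,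
        mul_assoc (a ^ p'), h7] at this
  | @star_D_mul k l n w _ ih =>
    obtain ih | ⟨hl, p, p', hp, ih⟩ := ih
    · exact .inl (mul_mem_powNull _ ih)
    · refine .inr ⟨hl, p, p', hp, ?_⟩
      have := mul_mem_powNull (star D) ih
      have h7 : star D * ((h.unitaryD ^ n : unitary B) : B) =
          (h.unitaryD ^ (-1 + n) : unitary B) := by
        rw [zpow_add, zpow_neg_one]; rfl
      rwa [mul_sub, ← mul_assoc, ← mul_assoc, (h.commute_a_star_D.symm.pow_right p').eq,
        mul_assoc (a ^ p'), h7] at this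

theorem word_mem_powNull (h : UqRel q a b D) (hq0 : q ≠ 0) (hq : ‖q‖ < 1) {k l n : ℤ} {w : B}
    (hw : UqWord a b D k l n w) (hl : l ≠ 0) : w ∈ powNull a :=
  (h.word_mem_powNull_or hq0 hq hw).resolve_right fun h' => hl h'.1

theorem exists_word_sub_smul_mem_powNull (h : UqRel q a b D) (hq0 : q ≠ 0) (hq : ‖q‖ < 1)
    {n : ℤ} {w : B} (hw : UqWord a b D 0 0 n w) :
    ∃ c : ℂ, w - c • ((h.unitaryD ^ n : unitary B) : B) ∈ powNull a := by
  obtain h1 | ⟨-, p, p', hp, h1⟩ := h.word_mem_powNull_or hq0 hq hw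
  · exact ⟨0, by simpa using h1⟩
  · refine ⟨1, mem_powNull_of_mul_pow_mem p ?_⟩
    obtain rfl : p' = p := by omega
    rwa [one_smul, sub_mul,
      ((h.commute_unitaryD_zpow h.aD h.commute_a_star_D n).pow_right p').eq]

theorem star_b_mul_b_mul_pow (h : UqRel q a b D) (m : ℕ) :
    star b * b * a ^ m = ((‖q‖ : ℂ) ^ 2) ^ m • (a ^ m * (star b * b)) := by
  have h0 : star b * b * a = ((‖q‖ : ℂ) ^ 2) • (a * (star b * b)) := by
    rw [mul_assoc, h.ba, mul_smul_comm, ← mul_assoc, h.star_b_mul_a, smul_mul_assoc, smul_smul,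
      mul_assoc, ← Complex.mul_conj']
    rfl
  induction m with
  | zero => simp
  | succ m ih =>
    rw [pow_succ, ← mul_assoc, ih, smul_mul_assoc, mul_assoc, h0, mul_smul_comm, smul_smul,
      ← pow_succ, mul_assoc]

/-- Left multiplication by `a` is almost isometric on `aᵐ x`, since `a* a = 1 - |q|² b* b` and
`b* b aᵐ = |q|²ᵐ aᵐ b* b`. -/
theorem norm_pow_mul_le (h : UqRel q a b D) {x : B} (hx : Commute (star b * b) x) (m : ℕ) :
    ‖a ^ m * x‖ ≤ ‖a ^ (m + 1) * x‖ + (‖q‖ ^ 2) ^ (m + 1) * ‖a ^ m * x‖ := by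
  have h1 : a ^ m * x = star a * (a ^ (m + 1) * x) +
      ((‖q‖ : ℂ) ^ 2) ^ (m + 1) • (a ^ m * x * (star b * b)) := by
    have h2 : star a * (a ^ (m + 1) * x) =
        a ^ m * x - ((‖q‖ : ℂ) ^ 2) • (star b * b * a ^ m * x) := by
      rw [pow_succ', mul_assoc a, ← mul_assoc (star a), eq_sub_of_add_eq h.sa_a, sub_mul, one_mul,
        smul_mul_assoc, mul_assoc _ _ x]
    rw [h2, h.star_b_mul_b_mul_pow, smul_mul_assoc, smul_smul, ← pow_succ', mul_assoc _ _ x, hx.eq,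
      ← mul_assoc, sub_add_cancel]
  have hN : ‖star b * b‖ ≤ 1 := by
    rw [CStarRing.norm_star_mul_self]
    exact mul_le_one₀ h.norm_b_le_one (norm_nonneg _) h.norm_b_le_one
  calc ‖a ^ m * x‖ ≤ ‖star a * (a ^ (m + 1) * x)‖ +
        ‖((‖q‖ : ℂ) ^ 2) ^ (m + 1) • (a ^ m * x * (star b * b))‖ := by
        conv_lhs => rw [h1]
        exact norm_add_le _ _
    _ ≤ _ := by
      refine add_le_add ((norm_mul_le _ _).trans ?_) ?_
      · rw [norm_star]
        exact mul_le_of_le_one_left (norm_nonneg _) h.norm_a_le_one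
      · rw [norm_smul, norm_pow, norm_pow, Complex.norm_real, norm_norm]
        exact mul_le_mul_of_nonneg_left ((norm_mul_le _ _).trans
          (mul_le_of_le_one_right (norm_nonneg _) hN)) (by positivity)

/-- The ideal `powNull a` contains no nonzero central element. -/
theorem eq_zero_of_mem_powNull (h : UqRel q a b D) (hq : ‖q‖ < 1) {x : B} (ha : Commute a x)
    (hx : Commute (star b * b) x) (hJ : x ∈ powNull a) : x = 0 := by
  set r := ‖q‖ ^ 2
  have hr0 : 0 ≤ r := by positivity
  have hr : r < 1 := pow_lt_one₀ (norm_nonneg q) hq two_ne_zero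
  set u : ℕ → ℝ := fun m => ‖a ^ m * x‖
  have hu0 : ∀ m, 0 ≤ u m := fun m => norm_nonneg _
  have hstep : ∀ m, u m ≤ u (m + 1) + r ^ (m + 1) * u m := h.norm_pow_mul_le hx
  have hlim : Tendsto u atTop (𝓝 0) := by
    have := (mem_powNull.1 hJ).norm
    rw [norm_zero] at this
    refine this.congr fun m => ?_
    rw [← (ha.pow_left m).eq]
  have hanti : Antitone u := antitone_nat_of_succ_le fun m => by
    change ‖a ^ (m + 1) * x‖ ≤ ‖a ^ m * x‖
    rw [pow_succ', mul_assoc]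
    simpa using h.norm_a_pow_le 1 (a ^ m * x)
  -- telescoping: from some `M` on, the total loss is at most half of `u M`
  obtain ⟨M, hM⟩ : ∃ M : ℕ, r ^ M < (1 - r) / 2 :=
    exists_pow_lt_of_lt_one (by linarith) hr
  have hsum : ∀ j, (1 - r) * (u M - u (M + j)) ≤ r ^ M * (1 - r ^ j) * u M := fun j => by
    induction j with
    | zero => simp
    | succ j ih =>
      have h1 := hstep (M + j)
      have h2 : r ^ (M + j + 1) * u (M + j) ≤ r ^ (M + j) * u M := by
        refine mul_le_mul (pow_le_pow_of_le_one hr0 hr.le (Nat.le_succ _))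
          (hanti (Nat.le_add_right _ _)) (hu0 _) (by positivity)
      have h3 : u (M + j) - u (M + j + 1) ≤ r ^ (M + j) * u M := by linarith
      have h4 := mul_le_mul_of_nonneg_left h3 (sub_nonneg.2 hr.le)
      calc (1 - r) * (u M - u (M + (j + 1)))
          = (1 - r) * (u M - u (M + j)) + (1 - r) * (u (M + j) - u (M + j + 1)) := by
            rw [← add_assoc]; ring
        _ ≤ r ^ M * (1 - r ^ j) * u M + (1 - r) * (r ^ (M + j) * u M) := add_le_add ih h4
        _ = _ := by ring
  have huM : u M = 0 := by
    have hlim' : Tendsto (fun j => (1 - r) * (u M - u (M + j))) atTop (𝓝 ((1 - r) * (u M - 0))) := by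
      refine (tendsto_const_nhds.sub ?_).const_mul _
      simpa only [add_comm] using (tendsto_add_atTop_iff_nat M).2 hlim
    have hle : (1 - r) * (u M - 0) ≤ r ^ M * u M := le_of_tendsto' hlim' fun j =>
      (hsum j).trans (mul_le_mul_of_nonneg_right
        (mul_le_of_le_one_right (by positivity) (sub_le_self _ (by positivity))) (hu0 M))
    nlinarith [hu0 M]
  have hdown : ∀ j, u (M - j) = 0 := fun j => by
    induction j with
    | zero => exact huM
    | succ j ih =>
      rcases Nat.lt_or_ge j M with hj | hj
      · have h1 := hstep (M - (j + 1))
        rw [show M - (j + 1) + 1 = M - j by omega, ih, zero_add] at h1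
        have h2 : r ^ (M - j) < 1 := pow_lt_one₀ hr0 hr (by omega)
        nlinarith [hu0 (M - (j + 1))]
      · rwa [Nat.sub_eq_zero_of_le (by omega), ← Nat.sub_eq_zero_of_le hj]
  have := hdown M
  simpa [u] using this

end UqRel

/-! ### Fourier coefficients of vector-valued functions -/

section Fourier

variable {E : Type*} [NormedAddCommGroup E] [NormedSpace ℂ E]

theorem ContinuousLinearMap.map_fourierCoeff [CompleteSpace E] {F : Type*} [NormedAddCommGroup F]
    [NormedSpace ℂ F] [CompleteSpace F] (L : E →L[ℂ] F) (f : C(UnitAddCircle, E)) (m : ℤ) :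
    L (fourierCoeff f m) = fourierCoeff (fun t => L (f t)) m := by
  rw [fourierCoeff, fourierCoeff, ← L.integral_comp_comm]
  · simp only [map_smul]
  · exact (f.continuous.integrable_of_hasCompactSupport
      (HasCompactSupport.of_compactSpace _)).fourier_smul _

/-- If all Fourier coefficients of a continuous function lie in a closed subspace, then so do its
values. -/
theorem apply_mem_of_fourierCoeff_mem [CompleteSpace E] {M : Submodule ℂ E}
    (hM : IsClosed (M : Set E)) (f : C(UnitAddCircle, E)) (hf : ∀ m, fourierCoeff f m ∈ M)
    (t : UnitAddCircle) : f t ∈ M := by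
  rw [← Submodule.Quotient.mk_eq_zero M]
  have : IsClosed (M : Set E) := hM
  refine SeparatingDual.eq_zero_of_forall_dual_eq_zero (R := ℂ) fun φ => ?_
  let L : E →L[ℂ] ℂ := φ.comp M.mkQL
  let g : C(UnitAddCircle, ℂ) := ⟨fun t => L (f t), L.continuous.comp f.continuous⟩
  have hg : fourierCoeff g = 0 := by
    funext m
    refine (L.map_fourierCoeff f m).symm.trans ?_
    change φ (M.mkQ _) = 0
    rw [Submodule.mkQ_apply, (Submodule.Quotient.mk_eq_zero M).2 (hf m), map_zero]
  have h1 := has_pointwise_sum_fourier_series_of_summable (f := g) (by rw [hg]; exact summable_zero) t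
  simp only [hg, Pi.zero_apply, zero_smul] at h1
  exact h1.unique hasSum_zero

theorem fourierCoeff_fourier_smul [CompleteSpace E] (x : E) (k m : ℤ) :
    fourierCoeff (fun t : UnitAddCircle => fourier k t • x) m = if k = m then x else 0 := by
  have h1 := congrFun (fourierCoeff_fourier (T := 1) k) m
  rw [fourierCoeff] at h1 ⊢
  simp only [smul_smul, smul_eq_mul] at h1 ⊢
  rw [integral_smul_const, h1]
  by_cases h : k = m
  · subst h; simp
  · rw [if_neg h, Pi.single_eq_of_ne (Ne.symm h), zero_smul]

end Fourier

/-! ### The gauge action and the homogeneous parts -/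

theorem UqRel.smul {q : ℂ} {B : Type*} [CStarAlgebra B] {a b D : B} (h : UqRel q a b D)
    {u v w : ℂ} (hu : u * star u = 1) (hv : v * star v = 1) (hw : w * star w = 1) :
    UqRel q (u • a) (v • b) (w • D) where
  ba := by
    simp only [smul_mul_assoc, mul_smul_comm, h.ba, smul_smul]; congr 1; ring
  sa_b := by
    simp only [star_smul, smul_mul_assoc, mul_smul_comm, h.sa_b, smul_smul]; congr 1; ring
  b_normal := by
    simp only [star_smul, smul_mul_assoc, mul_smul_comm, h.b_normal, smul_smul]; congr 1; ring
  a_sa := by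
    simp only [star_smul, smul_mul_assoc, mul_smul_comm, smul_smul, hu, hv, mul_comm (star _),
      one_smul, h.a_sa]
  aD := by
    simp only [smul_mul_assoc, mul_smul_comm, h.aD, smul_smul]; congr 1; ring
  bD := by
    simp only [smul_mul_assoc, mul_smul_comm, h.bD, smul_smul]; congr 1; ring
  D_sD := by
    simp only [star_smul, smul_mul_assoc, mul_smul_comm, smul_smul, hw, mul_comm (star _),
      one_smul, h.D_sD]
  sD_D := by
    simp only [star_smul, smul_mul_assoc, mul_smul_comm, smul_smul, hw,
      one_smul, h.sD_D]
  sa_a := by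
    simp only [star_smul, smul_mul_assoc, mul_smul_comm, smul_smul, hu, hv,
      one_smul, h.sa_a]

theorem fourier_mul_star (r : ℤ) (t : UnitAddCircle) : fourier r t * star (fourier r t) = 1 := by
  rw [Complex.star_def, ← fourier_neg, ← fourier_add, add_neg_cancel, fourier_zero]

namespace CUq2

variable {q : ℂ}

theorem gauge_rel (q : ℂ) (r s t : ℤ) :
    UqRel q (⟨fun x => fourier r x • a q, by fun_prop⟩ : C(UnitAddCircle, CUq2 q))
      ⟨fun x => fourier s x • b q, by fun_prop⟩ ⟨fun x => fourier t x • D q, by fun_prop⟩ := by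
  have h := fun x : UnitAddCircle => (rel q).smul (fourier_mul_star r x) (fourier_mul_star s x)
    (fourier_mul_star t x)
  exact ⟨ContinuousMap.ext fun x => (h x).ba, ContinuousMap.ext fun x => (h x).sa_b,
    ContinuousMap.ext fun x => (h x).b_normal, ContinuousMap.ext fun x => (h x).a_sa,
    ContinuousMap.ext fun x => (h x).aD, ContinuousMap.ext fun x => (h x).bD,
    ContinuousMap.ext fun x => (h x).D_sD, ContinuousMap.ext fun x => (h x).sD_D,
    ContinuousMap.ext fun x => (h x).sa_a⟩

/-- The gauge action of the circle on `C(U_q(2))` with weights `r, s, t` on `a, b, D`: it sends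
`x` to its orbit, a continuous function on the circle. -/
noncomputable def gauge (q : ℂ) (r s t : ℤ) : CUq2 q →⋆ₐ[ℂ] C(UnitAddCircle, CUq2 q) :=
  (existsUnique_hom (gauge_rel q r s t)).exists.choose

theorem gauge_a (r s t : ℤ) (x : UnitAddCircle) : gauge q r s t (a q) x = fourier r x • a q :=
  congrArg (fun f : C(UnitAddCircle, CUq2 q) => f x)
    (existsUnique_hom (gauge_rel q r s t)).exists.choose_spec.1

theorem gauge_b (r s t : ℤ) (x : UnitAddCircle) : gauge q r s t (b q) x = fourier s x • b q :=
  congrArg (fun f : C(UnitAddCircle, CUq2 q) => f x)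
    (existsUnique_hom (gauge_rel q r s t)).exists.choose_spec.2.1

theorem gauge_D (r s t : ℤ) (x : UnitAddCircle) : gauge q r s t (D q) x = fourier t x • D q :=
  congrArg (fun f : C(UnitAddCircle, CUq2 q) => f x)
    (existsUnique_hom (gauge_rel q r s t)).exists.choose_spec.2.2

theorem gauge_apply_zero (r s t : ℤ) (y : CUq2 q) : gauge q r s t y 0 = y := by
  let ev : CUq2 q →⋆ₐ[ℂ] CUq2 q :=
    { toFun := fun y => gauge q r s t y 0
      map_one' := by rw [map_one]; rfl
      map_mul' := fun x y => by rw [map_mul]; rfl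
      map_zero' := by rw [map_zero (gauge q r s t)]; rfl
      map_add' := fun x y => by rw [map_add]; rfl
      commutes' := fun c => by rw [AlgHomClass.commutes]; rfl
      map_star' := fun x => by rw [map_star]; rfl }
  have : ev = StarAlgHom.id ℂ (CUq2 q) := hom_ext
    ((gauge_a r s t 0).trans (by rw [fourier_eval_zero, one_smul]; rfl))
    ((gauge_b r s t 0).trans (by rw [fourier_eval_zero, one_smul]; rfl))
    ((gauge_D r s t 0).trans (by rw [fourier_eval_zero, one_smul]; rfl))
  exact DFunLike.congr_fun this y

theorem gauge_word (r s t : ℤ) {k l n : ℤ} {w : CUq2 q} (hw : UqWord (a q) (b q) (D q) k l n w)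
    (x : UnitAddCircle) : gauge q r s t w x = fourier (r * k + s * l + t * n) x • w := by
  have key : ∀ {g w : CUq2 q} {i j : ℤ} (m : ℤ), gauge q r s t g x = fourier i x • g →
      gauge q r s t w x = fourier j x • w → m = i + j →
      gauge q r s t (g * w) x = fourier m x • (g * w) := by
    rintro g w i j m hg hw rfl
    rw [map_mul, ContinuousMap.mul_apply, hg, hw, smul_mul_smul_comm, fourier_add]
  have hstar : ∀ {g : CUq2 q} {i : ℤ}, gauge q r s t g x = fourier i x • g →
      gauge q r s t (star g) x = fourier (-i) x • star g := by
    intro g i hg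
    rw [map_star, ContinuousMap.star_apply, hg, star_smul, fourier_neg]
    rfl
  induction hw with
  | one =>
    rw [map_one]
    simp only [mul_zero, add_zero, fourier_zero, one_smul, ContinuousMap.one_apply]
  | a_mul _ ih => exact key _ (gauge_a r s t x) ih (by ring)
  | star_a_mul _ ih => exact key _ (hstar (gauge_a r s t x)) ih (by ring)
  | b_mul _ ih => exact key _ (gauge_b r s t x) ih (by ring)
  | star_b_mul _ ih => exact key _ (hstar (gauge_b r s t x)) ih (by ring)
  | D_mul _ ih => exact key _ (gauge_D r s t x) ih (by ring)
  | star_D_mul _ ih => exact key _ (hstar (gauge_D r s t x)) ih (by ring)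

/-- A closed subspace that contains all words is everything. -/
theorem mem_of_word_mem {M : Submodule ℂ (CUq2 q)} (hM : IsClosed (M : Set (CUq2 q)))
    (h : ∀ k l n w, UqWord (a q) (b q) (D q) k l n w → w ∈ M) (x : CUq2 q) : x ∈ M := by
  let S : StarSubalgebra ℂ (CUq2 q) :=
    (StarAlgebra.adjoin ℂ ({a q, b q, D q} : Set (CUq2 q))).topologicalClosure
  have hS : IsClosed (S : Set (CUq2 q)) := StarSubalgebra.isClosed_topologicalClosure _
  have hmem : ∀ w ∈ ({a q, b q, D q} : Set (CUq2 q)), w ∈ S := fun w hw =>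
    StarSubalgebra.le_topologicalClosure _ (StarAlgebra.subset_adjoin ℂ _ hw)
  have hrel : UqRel q (⟨a q, hmem _ (by simp)⟩ : S) ⟨b q, hmem _ (by simp)⟩
      ⟨D q, hmem _ (by simp)⟩ := by
    have h := rel q
    exact ⟨Subtype.ext h.ba, Subtype.ext h.sa_b, Subtype.ext h.b_normal, Subtype.ext h.a_sa,
      Subtype.ext h.aD, Subtype.ext h.bD, Subtype.ext h.D_sD, Subtype.ext h.sD_D,
      Subtype.ext h.sa_a⟩
  obtain ⟨φ, hφa, hφb, hφD⟩ := (existsUnique_hom hrel).exists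
  have hφ : S.subtype.comp φ = StarAlgHom.id ℂ (CUq2 q) := hom_ext
    (congrArg S.subtype hφa) (congrArg S.subtype hφb) (congrArg S.subtype hφD)
  have hx : x ∈ S := by
    have h1 : ((φ x : S) : CUq2 q) = x := DFunLike.congr_fun hφ x
    rw [← h1]
    exact (φ x).2
  have h1 : (S : Set (CUq2 q)) ⊆ M := by
    refine closure_minimal (fun y hy => ?_) hM
    refine Submodule.span_le.2 ?_ (UqWord.mem_span hy)
    rintro w ⟨k, l, n, hw⟩
    exact h k l n w hw
  exact h1 hx

/-- The projection of `C(U_q(2))` onto the elements of degree `m` for the gauge action with weights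
`r, s, t`. -/
noncomputable def gaugeProj (q : ℂ) (r s t m : ℤ) : CUq2 q →L[ℂ] CUq2 q :=
  LinearMap.mkContinuous
    { toFun := fun x => fourierCoeff (gauge q r s t x) m
      map_add' := fun x y => by
        have hi : ∀ f : C(UnitAddCircle, CUq2 q),
            MeasureTheory.Integrable f AddCircle.haarAddCircle := fun f =>
          f.continuous.integrable_of_hasCompactSupport (HasCompactSupport.of_compactSpace _)
        rw [map_add, ContinuousMap.coe_add, fourierCoeff.add (hi _) (hi _)]
        rfl
      map_smul' := fun c x => by
        rw [map_smul, ContinuousMap.coe_smul, fourierCoeff.const_smul]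
        rfl }
    1 fun x => by
      rw [one_mul]
      refine (MeasureTheory.norm_integral_le_of_norm_le_const (C := ‖x‖)
        (.of_forall fun t' => ?_)).trans_eq ?_
      · rw [norm_smul, fourier_apply, Circle.norm_coe, one_mul]
        exact (ContinuousMap.norm_coe_le_norm _ _).trans
          (NonUnitalStarAlgHom.norm_apply_le (gauge q r s t) x)
      · simp

theorem gaugeProj_apply (r s t m : ℤ) (x : CUq2 q) :
    gaugeProj q r s t m x = fourierCoeff (gauge q r s t x) m := rfl

theorem gaugeProj_word (r s t m : ℤ) {k l n : ℤ} {w : CUq2 q}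
    (hw : UqWord (a q) (b q) (D q) k l n w) :
    gaugeProj q r s t m w = if r * k + s * l + t * n = m then w else 0 := by
  rw [gaugeProj_apply, ← fourierCoeff_fourier_smul]
  congr 1
  funext x
  exact gauge_word r s t hw x

theorem mem_of_gaugeProj_mem {M : Submodule ℂ (CUq2 q)} (hM : IsClosed (M : Set (CUq2 q)))
    (r s t : ℤ) {x : CUq2 q} (h : ∀ m, gaugeProj q r s t m x ∈ M) : x ∈ M := by
  rw [← gauge_apply_zero r s t x]
  exact apply_mem_of_fourierCoeff_mem hM _ h 0

/-- The projection onto the elements of degree `k, l, n` in `a, b, D`. -/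
noncomputable def degProj (q : ℂ) (k l n : ℤ) : CUq2 q →L[ℂ] CUq2 q :=
  (gaugeProj q 0 0 1 n).comp ((gaugeProj q 0 1 0 l).comp (gaugeProj q 1 0 0 k))

theorem mem_of_degProj_mem {M : Submodule ℂ (CUq2 q)} (hM : IsClosed (M : Set (CUq2 q)))
    {x : CUq2 q} (h : ∀ k l n, degProj q k l n x ∈ M) : x ∈ M :=
  mem_of_gaugeProj_mem hM 1 0 0 fun k => mem_of_gaugeProj_mem hM 0 1 0 fun l =>
    mem_of_gaugeProj_mem hM 0 0 1 fun n => h k l n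

theorem degProj_word {k l n k' l' n' : ℤ} {w : CUq2 q}
    (hw : UqWord (a q) (b q) (D q) k' l' n' w) :
    degProj q k l n w = if k' = k ∧ l' = l ∧ n' = n then w else 0 := by
  simp only [degProj, ContinuousLinearMap.comp_apply]
  rw [gaugeProj_word 1 0 0 k hw]
  simp only [one_mul, zero_mul, add_zero]
  by_cases hk : k' = k
  · rw [if_pos hk, gaugeProj_word 0 1 0 l hw]
    simp only [one_mul, zero_mul, add_zero, zero_add]
    by_cases hl : l' = l
    · rw [if_pos hl, gaugeProj_word 0 0 1 n hw]
      simp only [one_mul, zero_mul, zero_add, hk, hl, true_and]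
    · simp [hl]
  · simp [hk]

/-- To prove that the elements of degree `k, l, n` lie in a closed subspace it is enough to look
at words. -/
theorem degProj_mem {k l n : ℤ} {M : Submodule ℂ (CUq2 q)} (hM : IsClosed (M : Set (CUq2 q)))
    (h : ∀ w, UqWord (a q) (b q) (D q) k l n w → w ∈ M) (x : CUq2 q) : degProj q k l n x ∈ M := by
  refine mem_of_word_mem (M := M.comap (degProj q k l n).toLinearMap)
    (hM.preimage (degProj q k l n).continuous) (fun k' l' n' w hw => ?_) x
  change degProj q k l n w ∈ M
  rw [degProj_word hw]
  split_ifs with hd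
  · obtain ⟨rfl, rfl, rfl⟩ := hd
    exact h w hw
  · exact M.zero_mem

/-- An equality of continuous linear maps on the elements of degree `k, l, n` can be tested on
words. -/
theorem degProj_eq {k l n : ℤ} {F : Type*} [NormedAddCommGroup F] [NormedSpace ℂ F]
    (L L' : CUq2 q →L[ℂ] F) (h : ∀ w, UqWord (a q) (b q) (D q) k l n w → L w = L' w)
    (x : CUq2 q) : L (degProj q k l n x) = L' (degProj q k l n x) :=
  degProj_mem (M := LinearMap.eqLocus L.toLinearMap L'.toLinearMap)
    (isClosed_eq L.continuous L'.continuous) h x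

theorem commute_gaugeProj {x : CUq2 q} (hx : ∀ y, Commute y x) (r s t m : ℤ) (y : CUq2 q) :
    Commute y (gaugeProj q r s t m x) := by
  have hw : ∀ k l n w, UqWord (a q) (b q) (D q) k l n w →
      w * gaugeProj q r s t m x = gaugeProj q r s t m x * w := fun k l n w hw => by
    have h1 := ContinuousLinearMap.map_fourierCoeff (ContinuousLinearMap.mul ℂ (CUq2 q) w)
      (gauge q r s t x) m
    have h2 := ContinuousLinearMap.map_fourierCoeff
      ((ContinuousLinearMap.mul ℂ (CUq2 q)).flip w) (gauge q r s t x) m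
    refine h1.trans (Eq.trans ?_ h2.symm)
    congr 1
    funext t'
    have h3 : gauge q r s t (w * x) t' = gauge q r s t (x * w) t' := by rw [(hx w).eq]
    rw [map_mul, map_mul, ContinuousMap.mul_apply, ContinuousMap.mul_apply, gauge_word r s t hw,
      smul_mul_assoc, mul_smul_comm] at h3
    have h4 : fourier (r * k + s * l + t * n) t' ≠ 0 := by
      rw [fourier_apply]; exact Circle.coe_ne_zero _
    exact smul_right_injective _ h4 h3
  exact mem_of_word_mem (M := LinearMap.eqLocus
      ((ContinuousLinearMap.mul ℂ (CUq2 q)).flip (gaugeProj q r s t m x)).toLinearMap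
      (ContinuousLinearMap.mul ℂ (CUq2 q) (gaugeProj q r s t m x)).toLinearMap)
    (isClosed_eq (ContinuousLinearMap.continuous _) (ContinuousLinearMap.continuous _)) hw y

theorem commute_degProj {x : CUq2 q} (hx : ∀ y, Commute y x) (k l n : ℤ) (y : CUq2 q) :
    Commute y (degProj q k l n x) :=
  commute_gaugeProj (commute_gaugeProj (commute_gaugeProj hx 1 0 0 k) 0 1 0 l) 0 0 1 n y

/-- `y` of degree `k, l, n` means that `y* y` has degree zero. -/
theorem degProj_star_mul_self (k l n : ℤ) (x : CUq2 q) :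
    degProj q 0 0 0 (star (degProj q k l n x) * degProj q k l n x) =
      star (degProj q k l n x) * degProj q k l n x := by
  set y := degProj q k l n x
  have h1 : ∀ r s t, gaugeProj q r s t 0 (star y * y) = star y * y := fun r s t => by
    have h2 : ∀ t', gauge q r s t (star y * y) t' = (fourier 0 t' : ℂ) • (star y * y) := fun t' => by
      let L : CUq2 q →L[ℂ] CUq2 q := LinearMap.mkContinuous
        { toFun := fun x => gauge q r s t x t'
          map_add' := fun x y => by rw [map_add]; rfl
          map_smul' := fun c x => by rw [map_smul]; rfl } 1 fun x => by
            rw [one_mul]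
            exact (ContinuousMap.norm_coe_le_norm _ _).trans
              (NonUnitalStarAlgHom.norm_apply_le (gauge q r s t) x)
      have h3 : gauge q r s t y t' = fourier (r * k + s * l + t * n) t' • y :=
        degProj_eq L ((fourier (r * k + s * l + t * n) t' : ℂ) • ContinuousLinearMap.id ℂ (CUq2 q))
          (fun w hw => gauge_word r s t hw t') x
      rw [map_mul, map_star, ContinuousMap.mul_apply, ContinuousMap.star_apply, h3, star_smul,
        smul_mul_smul_comm, mul_comm, fourier_mul_star, fourier_zero]
    rw [gaugeProj_apply, show ⇑(gauge q r s t (star y * y)) =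
      fun t' => (fourier 0 t' : ℂ) • (star y * y) from funext h2, fourierCoeff_fourier_smul,
      if_pos rfl]
  rw [degProj, ContinuousLinearMap.comp_apply, ContinuousLinearMap.comp_apply, h1, h1, h1]

end CUq2

/-! ### A representation in which `b` does not vanish -/

/-- The weighted composition operator `x ↦ (i ↦ d i * x (σ i))` on `ℓ²`, for an injective map `σ`
and weights of modulus at most one. -/
noncomputable def weightedComp {ι : Type*} (σ : ι → ι) (hσ : Function.Injective σ) (d : ι → ℂ)
    (hd : ∀ i, ‖d i‖ ≤ 1) : lp (fun _ : ι => ℂ) 2 →L[ℂ] lp (fun _ : ι => ℂ) 2 :=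
  have hle : ∀ (x : lp (fun _ : ι => ℂ) 2) (i : ι),
      ‖d i * x (σ i)‖ ^ (2 : ℝ≥0∞).toReal ≤ ‖x (σ i)‖ ^ (2 : ℝ≥0∞).toReal := fun x i => by
    rw [norm_mul]
    exact Real.rpow_le_rpow (by positivity)
      (mul_le_of_le_one_left (norm_nonneg _) (hd i)) ENNReal.toReal_nonneg
  have hs : ∀ x : lp (fun _ : ι => ℂ) 2, Summable fun i => ‖x i‖ ^ (2 : ℝ≥0∞).toReal := fun x =>
    (lp.memℓp x).summable (by norm_num)
  have hs' : ∀ x : lp (fun _ : ι => ℂ) 2,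
      Summable fun i => ‖d i * x (σ i)‖ ^ (2 : ℝ≥0∞).toReal := fun x =>
    Summable.of_nonneg_of_le (fun i => by positivity) (hle x) ((hs x).comp_injective hσ)
  LinearMap.mkContinuous
    { toFun := fun x => ⟨fun i => d i * x (σ i), memℓp_gen (hs' x)⟩
      map_add' := fun x y => lp.ext (funext fun i => mul_add _ _ _)
      map_smul' := fun c x => lp.ext (funext fun i => mul_left_comm _ _ _) } 1 fun x => by
    rw [one_mul]
    refine lp.norm_le_of_tsum_le (by norm_num) (norm_nonneg x) ?_
    rw [lp.norm_rpow_eq_tsum (by norm_num)]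
    exact ((hs' x).tsum_le_tsum (hle x) ((hs x).comp_injective hσ)).trans
      (tsum_comp_le_tsum_of_inj (hs x) (fun i => by positivity) hσ)

section weightedComp

variable {ι : Type*} {σ : ι → ι} {hσ : Function.Injective σ} {d : ι → ℂ} {hd : ∀ i, ‖d i‖ ≤ 1}

theorem weightedComp_apply (x : lp (fun _ : ι => ℂ) 2) (i : ι) :
    weightedComp σ hσ d hd x i = d i * x (σ i) := rfl

theorem star_weightedComp_apply [DecidableEq ι] (x : lp (fun _ : ι => ℂ) 2) (i : ι) :
    star (weightedComp σ hσ d hd) x i =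
      inner ℂ (weightedComp σ hσ d hd (lp.single 2 i 1)) x := by
  have h1 := lp.inner_single_left (𝕜 := ℂ) i (1 : ℂ) (star (weightedComp σ hσ d hd) x)
  rw [ContinuousLinearMap.star_eq_adjoint, ContinuousLinearMap.adjoint_inner_right] at h1
  rw [h1]
  simp [ContinuousLinearMap.star_eq_adjoint]

theorem star_weightedComp_apply_map (x : lp (fun _ : ι => ℂ) 2) (i : ι) :
    star (weightedComp σ hσ d hd) x (σ i) = star (d i) * x i := by
  classical
  have h1 : weightedComp σ hσ d hd (lp.single 2 (σ i) 1) = lp.single 2 i (d i) := by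
    ext j
    rw [weightedComp_apply]
    rcases eq_or_ne j i with rfl | hj
    · simp
    · rw [lp.single_apply_ne _ _ _ hj, lp.single_apply_ne _ _ _ (hσ.ne hj), mul_zero]
  rw [star_weightedComp_apply, h1, lp.inner_single_left]
  simp [mul_comm]

theorem star_weightedComp_apply_of_notMem (x : lp (fun _ : ι => ℂ) 2) {i : ι}
    (hi : i ∉ Set.range σ) : star (weightedComp σ hσ d hd) x i = 0 := by
  classical
  have h1 : weightedComp σ hσ d hd (lp.single 2 i 1) = 0 := by
    ext j
    rw [weightedComp_apply, lp.single_apply_ne _ _ _ fun h => hi ⟨j, h⟩, mul_zero]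
    rfl
  rw [star_weightedComp_apply, h1, inner_zero_left]

end weightedComp

/-- For `|q| < 1`, the relations have a solution with `b ≠ 0` in the operators on `ℓ²(ℕ × ℤ)`: with
`s_m = (1 - |q|^{2m+2})^{1/2}` it is
`a e_{m,j} = s_m e_{m+1,j}`, `b e_{m,j} = q^m ω^j e_{m,j}` and `D e_{m,j} = e_{m,j+1}`,
where `ω = q² / |q|²`. -/
theorem exists_uqRel_ne_zero {q : ℂ} (hq0 : q ≠ 0) (hq : ‖q‖ < 1) :
    ∃ a b D : lp (fun _ : ℕ × ℤ => ℂ) 2 →L[ℂ] lp (fun _ : ℕ × ℤ => ℂ) 2,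
      UqRel q a b D ∧ b ≠ 0 := by
  have hω := norm_uqPhase hq0
  have hω0 := uqPhase_ne_zero hq0
  have hr : ∀ m : ℕ, 0 ≤ 1 - (‖q‖ ^ 2) ^ (m + 1) := fun m =>
    sub_nonneg.2 (pow_le_one₀ (by positivity) (pow_le_one₀ (norm_nonneg q) hq.le))
  let s : ℕ → ℝ := fun m => √(1 - (‖q‖ ^ 2) ^ (m + 1))
  have hs : ∀ m, (s m : ℂ) * s m = 1 - ((‖q‖ : ℂ) ^ 2) ^ (m + 1) := fun m => by
    rw [← Complex.ofReal_mul, Real.mul_self_sqrt (hr m)]; push_cast; rfl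
  have hs1 : ∀ m, ‖(s m : ℂ)‖ ≤ 1 := fun m => by
    rw [Complex.norm_real, Real.norm_of_nonneg (Real.sqrt_nonneg _)]
    exact Real.sqrt_le_one.2 (sub_le_self _ (by positivity))
  let β : ℕ × ℤ → ℂ := fun i => q ^ i.1 * uqPhase q ^ i.2
  have hβ1 : ∀ i, ‖β i‖ ≤ 1 := fun i => by
    rw [norm_mul, norm_zpow, hω, one_zpow, mul_one, norm_pow]
    exact pow_le_one₀ (norm_nonneg q) hq.le
  have hββ : ∀ i, β i * star (β i) = ((‖q‖ : ℂ) ^ 2) ^ i.1 := fun i => by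
    rw [Complex.star_def, Complex.mul_conj', norm_mul, norm_zpow, hω, one_zpow, mul_one, norm_pow]
    push_cast; ring
  -- the adjoint of `a`, and `D`, are weighted composition operators
  let A := weightedComp (fun i : ℕ × ℤ => (i.1 + 1, i.2))
    (fun i j h => by simpa [Prod.ext_iff] using h) (fun i => (s i.1 : ℂ)) (fun i => hs1 i.1)
  let b := weightedComp (fun i : ℕ × ℤ => i) (fun i j h => h) β hβ1
  let D := weightedComp (fun i : ℕ × ℤ => (i.1, i.2 - 1))
    (fun i j h => by simpa [Prod.ext_iff] using h) (fun _ => 1) (fun _ => by simp)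
  have hA : ∀ x m j, A x (m, j) = s m * x (m + 1, j) := fun x m j => rfl
  have hb : ∀ x i, b x i = β i * x i := fun x i => rfl
  have hD : ∀ x m j, D x (m, j) = x (m, j - 1) := fun x m j => one_mul _
  have hA1 : ∀ x m j, star A x (m + 1, j) = s m * x (m, j) := fun x m j =>
    (star_weightedComp_apply_map x (m, j)).trans (by simp)
  have hA0 : ∀ x j, star A x (0, j) = 0 := fun x j =>
    star_weightedComp_apply_of_notMem x (by simp)
  have hb' : ∀ x i, star b x i = star (β i) * x i := fun x i => star_weightedComp_apply_map x i
  have hD' : ∀ x m j, star D x (m, j) = x (m, j + 1) := fun x m j => by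
    have := star_weightedComp_apply_map (hσ := fun i j h => by simpa [Prod.ext_iff] using h)
      (σ := fun i : ℕ × ℤ => (i.1, i.2 - 1)) (d := fun _ => 1) (hd := fun _ => by simp) x (m, j + 1)
    simpa using this
  have hext : ∀ S T : lp (fun _ : ℕ × ℤ => ℂ) 2 →L[ℂ] lp (fun _ : ℕ × ℤ => ℂ) 2,
      (∀ x m j, S x (m, j) = T x (m, j)) → S = T := fun S T h =>
    ContinuousLinearMap.ext fun x => lp.ext (funext fun i => h x i.1 i.2)
  have hβs : ∀ m j, β (m + 1, j) = q * β (m, j) := fun m j => by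
    simp only [β, pow_succ]; ring
  have hβj : ∀ m j, β (m, j) = uqPhase q * β (m, j - 1) := fun m j => by
    simp only [β]
    rw [mul_left_comm, ← zpow_one_add₀ hω0, add_sub_cancel]
  refine ⟨star A, b, D, ⟨?_, ?_, ?_, ?_, ?_, ?_, ?_, ?_, ?_⟩, fun h => ?_⟩
  · refine hext _ _ fun x m j => ?_
    change b (star A x) (m, j) = q * star A (b x) (m, j)
    rcases m with _ | m
    · rw [hb, hA0, hA0, mul_zero, mul_zero]
    · rw [hb, hA1, hA1, hb, hβs]; ring
  · refine hext _ _ fun x m j => ?_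
    rw [star_star]
    change A (b x) (m, j) = q * b (A x) (m, j)
    rw [hb, hA, hA, hb, hβs]; ring
  · refine hext _ _ fun x m j => ?_
    change b (star b x) (m, j) = star b (b x) (m, j)
    rw [hb, hb', hb', hb]; ring
  · refine hext _ _ fun x m j => ?_
    rw [star_star]
    change star A (A x) (m, j) + b (star b x) (m, j) = x (m, j)
    rw [hb, hb', ← mul_assoc, hββ]
    rcases m with _ | m
    · rw [hA0, pow_zero, one_mul, zero_add]
    · rw [hA1, hA, ← mul_assoc, hs]; ring
  · refine hext _ _ fun x m j => ?_
    change star A (D x) (m, j) = D (star A x) (m, j)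
    rcases m with _ | m
    · rw [hD, hA0, hA0]
    · rw [hD, hA1, hA1, hD]
  · refine hext _ _ fun x m j => ?_
    change b (D x) (m, j) = uqPhase q * D (b x) (m, j)
    rw [hD, hb, hb, hD, hβj]; ring
  · refine hext _ _ fun x m j => ?_
    change D (star D x) (m, j) = x (m, j)
    rw [hD, hD', sub_add_cancel]
  · refine hext _ _ fun x m j => ?_
    change star D (D x) (m, j) = x (m, j)
    rw [hD', hD, add_sub_cancel_right]
  · refine hext _ _ fun x m j => ?_
    rw [star_star]
    change A (star A x) (m, j) + (‖q‖ : ℂ) ^ 2 * star b (b x) (m, j) = x (m, j)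
    rw [hA, hA1, hb', hb, ← mul_assoc (s m : ℂ), hs, ← mul_assoc (star (β _)), mul_comm (star (β _)),
      hββ]
    ring
  · have h1 := hb (lp.single 2 (0, 0) 1) (0, 0)
    rw [h, lp.single_apply_self] at h1
    simp [β] at h1

/-! ### Homogeneous parts of central elements -/

namespace CUq2

variable {q : ℂ}

theorem exists_character (q : ℂ) {u v : ℂ} (hu : u * star u = 1) (hv : v * star v = 1) :
    ∃ φ : CUq2 q →⋆ₐ[ℂ] ℂ, φ (a q) = u ∧ φ (b q) = 0 ∧ φ (D q) = v := by
  have hu' : star u * u = 1 := (mul_comm _ _).trans hu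
  have hv' : star v * v = 1 := (mul_comm _ _).trans hv
  refine (existsUnique_hom ⟨?_, ?_, ?_, ?_, mul_comm u v, ?_, hv, hv', ?_⟩).exists
  · rw [zero_mul, mul_zero, smul_zero]
  · rw [zero_mul, mul_zero, smul_zero]
  · rw [star_zero]
  · rw [hu, zero_mul, add_zero]
  · rw [zero_mul, mul_zero, smul_zero]
  · rw [hu', mul_zero, smul_zero, add_zero]

theorem b_ne_zero (hq0 : q ≠ 0) (hq : ‖q‖ < 1) : b q ≠ 0 := by
  obtain ⟨a', b', D', h, hb⟩ := exists_uqRel_ne_zero hq0 hq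
  obtain ⟨φ, -, hφ, -⟩ := (existsUnique_hom h).exists
  intro h0
  rw [h0, map_zero] at hφ
  exact hb hφ.symm

theorem apply_eq_zero_of_mem_powNull {φ : CUq2 q →⋆ₐ[ℂ] ℂ} (hφ : φ (a q) = 1) {y : CUq2 q}
    (hy : y ∈ powNull (a q)) : φ y = 0 := by
  have hc : Continuous φ := AddMonoidHomClass.continuous_of_bound φ 1 fun x => by
    simpa using NonUnitalStarAlgHom.norm_apply_le φ x
  have h1 := (hc.tendsto 0).comp (mem_powNull.1 hy)
  rw [map_zero] at h1
  refine tendsto_nhds_unique ?_ h1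
  simp only [Function.comp_def, map_mul, map_pow, hφ, one_pow, mul_one]
  exact tendsto_const_nhds

/-- An element of degree `0` in `a` and `b` is a multiple of a power of `D` up to
`powNull (a q)`. The scalar is the value of the character `a, D ↦ 1`, `b ↦ 0`: this passes from
words to all elements because it is continuous. -/
theorem exists_degProj_sub_mem_powNull (hq0 : q ≠ 0) (hq : ‖q‖ < 1) (n : ℤ) (x : CUq2 q) :
    ∃ c : ℂ, degProj q 0 0 n x - c • (((rel q).unitaryD ^ n : unitary (CUq2 q)) : CUq2 q) ∈
      powNull (a q) := by
  obtain ⟨φ, hφa, -, hφD⟩ := exists_character q (u := 1) (v := 1) (by simp) (by simp)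
  set V := (((rel q).unitaryD ^ n : unitary (CUq2 q)) : CUq2 q) with hV
  have hφV : φ V = 1 := by
    let ψ : CUq2 q →⋆* ℂ :=
      { toFun := φ, map_one' := map_one φ, map_mul' := map_mul φ, map_star' := map_star φ }
    have h2 : Unitary.map ψ (rel q).unitaryD = 1 := Subtype.ext hφD
    have h3 : Unitary.map ψ ((rel q).unitaryD ^ n) = 1 := by
      rw [map_zpow, h2, one_zpow]
    exact congrArg Subtype.val h3
  let Φ : CUq2 q →L[ℂ] ℂ := LinearMap.mkContinuous φ.toAlgHom.toLinearMap 1 fun x => by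
    rw [one_mul]; exact NonUnitalStarAlgHom.norm_apply_le φ x
  let L : CUq2 q →L[ℂ] CUq2 q := ContinuousLinearMap.id ℂ _ - Φ.smulRight V
  have hL : ∀ y, L y = y - φ y • V := fun y => rfl
  refine ⟨φ (degProj q 0 0 n x), ?_⟩
  refine degProj_mem (M := (powNull (a q)).comap L.toLinearMap)
    ((isClosed_powNull (rel q).norm_a_le_one).preimage L.continuous) (fun w hw => ?_) x
  change w - φ w • V ∈ powNull (a q)
  obtain ⟨c, hc⟩ := (rel q).exists_word_sub_smul_mem_powNull hq0 hq hw
  have h3 := apply_eq_zero_of_mem_powNull hφa hc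
  rw [map_sub, map_smul, hφV, smul_eq_mul, mul_one, sub_eq_zero] at h3
  rwa [h3]

theorem eq_zero_of_central (hq : ‖q‖ < 1) {x : CUq2 q} (hx : ∀ y, Commute y x)
    (hJ : x ∈ powNull (a q)) : x = 0 :=
  (rel q).eq_zero_of_mem_powNull hq (hx _) (hx _) hJ

theorem degProj_eq_zero_of_ne (hq0 : q ≠ 0) (hq : ‖q‖ < 1) {x : CUq2 q} (hx : ∀ y, Commute y x)
    {k l n : ℤ} (hl : l ≠ 0) : degProj q k l n x = 0 :=
  eq_zero_of_central hq (commute_degProj hx k l n)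
    (degProj_mem (isClosed_powNull (rel q).norm_a_le_one)
      (fun _ hw => (rel q).word_mem_powNull hq0 hq hw hl) x)

/-- A homogeneous central element `y` that commutes with `b` up to a scalar other than `1` satisfies
`b y = 0`. Since `y* y` is scalar and `b ≠ 0`, it vanishes. -/
theorem degProj_eq_zero_of_phase_ne (hq0 : q ≠ 0) (hq : ‖q‖ < 1) {x : CUq2 q}
    (hx : ∀ y, Commute y x) {k l n : ℤ} (h1 : q ^ k * uqPhase q ^ n ≠ 1) :
    degProj q k l n x = 0 := by
  set y := degProj q k l n x with hy
  have hyc : ∀ z, Commute z y := commute_degProj hx k l n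
  have hby : b q * y = (q ^ k * uqPhase q ^ n) • (y * b q) :=
    degProj_eq (ContinuousLinearMap.mul ℂ (CUq2 q) (b q))
      ((q ^ k * uqPhase q ^ n) • (ContinuousLinearMap.mul ℂ (CUq2 q)).flip (b q))
      (fun w hw => (rel q).b_mul_word hq0 hw) x
  have hby0 : b q * y = 0 := by
    rw [← (hyc (b q)).eq, ← sub_eq_zero, ← one_smul ℂ (b q * y), smul_smul, mul_one, ← sub_smul]
      at hby
    exact (smul_eq_zero.1 hby).resolve_left (sub_ne_zero.2 (Ne.symm h1))
  have hyc' : ∀ z, Commute z (star y) := fun z => commute_star_comm.1 (hyc (star z))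
  have hyy : ∀ z, Commute z (star y * y) := fun z => (hyc' z).mul_right (hyc z)
  obtain ⟨c, hc⟩ := exists_degProj_sub_mem_powNull hq0 hq 0 (star y * y)
  rw [hy, degProj_star_mul_self, ← hy, zpow_zero, OneMemClass.coe_one] at hc
  have h2 : star y * y = c • 1 := sub_eq_zero.1 (eq_zero_of_central hq
    (fun z => (hyy z).sub_right ((Commute.one_right z).smul_right c)) hc)
  have h3 : c • b q = 0 := by
    have : star y * y * b q = c • b q := by rw [h2, smul_mul_assoc, one_mul]
    rw [← this, mul_assoc, ← (hyc (b q)).eq, hby0, mul_zero]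
  rw [(smul_eq_zero.1 h3).resolve_right (b_ne_zero hq0 hq), zero_smul] at h2
  exact CStarRing.star_mul_self_eq_zero_iff y |>.1 h2

/-- The homogeneous parts of a central element vanish, except those of degree `0, 0, n` with
`ωⁿ = 1`, where `ω = q² / |q|²`. The latter are multiples of `Dⁿ` if `Dⁿ` is central: the
difference is a central element of `powNull (a q)`. -/
theorem degProj_central_mem (hq0 : q ≠ 0) (hq : ‖q‖ < 1) {x : CUq2 q} (hx : ∀ y, Commute y x)
    (M : Submodule ℂ (CUq2 q))
    (hM : ∀ n : ℤ, uqPhase q ^ n = 1 →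
      (((rel q).unitaryD ^ n : unitary (CUq2 q)) : CUq2 q) ∈ M ∧
        ∀ y, Commute y (((rel q).unitaryD ^ n : unitary (CUq2 q)) : CUq2 q))
    (k l n : ℤ) : degProj q k l n x ∈ M := by
  by_cases hl : l = 0
  swap
  · rw [degProj_eq_zero_of_ne hq0 hq hx hl]; exact M.zero_mem
  by_cases h1 : q ^ k * uqPhase q ^ n = 1
  swap
  · rw [degProj_eq_zero_of_phase_ne hq0 hq hx h1]; exact M.zero_mem
  have hk : k = 0 := by
    have h2 := congrArg norm h1
    rw [norm_mul, norm_zpow, norm_zpow, norm_uqPhase hq0, one_zpow, mul_one, norm_one] at h2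
    exact (zpow_eq_one_iff_right₀ (norm_nonneg q) hq.ne).1 h2
  subst hl hk
  rw [zpow_zero, one_mul] at h1
  obtain ⟨h3, h4⟩ := hM n h1
  obtain ⟨c, hc⟩ := exists_degProj_sub_mem_powNull hq0 hq n x
  rw [sub_eq_zero.1 (eq_zero_of_central hq
    (fun z => (commute_degProj hx 0 0 n z).sub_right ((h4 z).smul_right c)) hc)]
  exact M.smul_mem c h3

theorem central_mem_elemental_of_norm_lt (hq0 : q ≠ 0) (hq : ‖q‖ < 1)
    (hD : ∀ y, Commute y (D q)) {x : CUq2 q} (hx : ∀ y, Commute y x) :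
    x ∈ StarAlgebra.elemental ℂ (D q) := by
  have hmem : ∀ n : ℤ, (((rel q).unitaryD ^ n : unitary (CUq2 q)) : CUq2 q) ∈
      StarAlgebra.elemental ℂ (D q) := fun n => by
    induction n with
    | zero => exact one_mem _
    | succ n ih =>
      rw [zpow_add_one, Submonoid.coe_mul]
      exact mul_mem ih (StarAlgebra.elemental.self_mem ℂ _)
    | pred n ih =>
      rw [zpow_sub_one, Submonoid.coe_mul]
      exact mul_mem ih (StarAlgebra.elemental.star_self_mem ℂ _)
  refine mem_of_degProj_mem
    (M := Subalgebra.toSubmodule (StarAlgebra.elemental ℂ (D q)).toSubalgebra)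
    (StarAlgebra.elemental.isClosed ℂ (D q))
    (degProj_central_mem hq0 hq hx _ fun n _ => ⟨hmem n, fun y => ?_⟩)
  refine ((rel q).commute_unitaryD_zpow (hD y) ?_ n).symm
  exact commute_star_comm.1 (hD (star y))

theorem central_mem_range_of_norm_lt (hq0 : q ≠ 0) (hq : ‖q‖ < 1)
    (hω : ∀ n : ℤ, uqPhase q ^ n = 1 → n = 0) {x : CUq2 q} (hx : ∀ y, Commute y x) :
    x ∈ Set.range (algebraMap ℂ (CUq2 q)) := by
  have h1 : x ∈ Submodule.span ℂ {(1 : CUq2 q)} := by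
    refine mem_of_degProj_mem (Submodule.closed_of_finiteDimensional _)
      (degProj_central_mem hq0 hq hx _ fun n hn => ?_)
    rw [hω n hn, zpow_zero, OneMemClass.coe_one]
    exact ⟨Submodule.mem_span_singleton_self _, Commute.one_right⟩
  obtain ⟨c, rfl⟩ := Submodule.mem_span_singleton.1 h1
  exact ⟨c, Algebra.algebraMap_eq_smul_one c⟩

/-! ### The center, for `|q| > 1` as well -/

/-- `a*, |q| b, D*` satisfy the relations for `q⁻¹`. -/
theorem rel_inv (hq0 : q ≠ 0) :
    UqRel q⁻¹ (star (a q)) ((‖q‖ : ℂ) • b q) (star (D q)) := by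
  have h := rel q
  have hn : (‖q‖ : ℂ) ≠ 0 := by simpa using hq0
  have hs : star (‖q‖ : ℂ) = ‖q‖ := Complex.conj_ofReal _
  constructor
  · rw [smul_mul_assoc, mul_smul_comm, h.b_mul_star_a hq0, smul_comm]
  · rw [star_star, smul_mul_assoc, mul_smul_comm, h.ba, smul_comm _ q, inv_smul_smul₀ hq0]
  · rw [star_smul, smul_mul_smul_comm, smul_mul_smul_comm, h.b_normal, mul_comm]
  · rw [star_star, star_smul, smul_mul_smul_comm, hs, h.b_normal, ← sq, h.sa_a]
  · have := congrArg star h.aD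
    rw [star_mul, star_mul] at this
    exact this.symm
  · have h1 := h.b_mul_star_D hq0
    rw [← uqPhase_inv] at h1
    rw [smul_mul_assoc, mul_smul_comm, h1, smul_comm]
    rfl
  · rw [star_star, h.sD_D]
  · rw [star_star, h.D_sD]
  · rw [star_star, star_smul, smul_mul_smul_comm, hs, ← sq, smul_smul, ← mul_pow, norm_inv,
      Complex.ofReal_inv, inv_mul_cancel₀ hn, one_pow, one_smul, ← h.b_normal, h.a_sa]

/-- The symmetry `C(U_q(2)) ≅ C(U_{q⁻¹}(2))` that sends `D` to `D*`. It reduces `|q| > 1` to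
`|q| < 1`. -/
theorem exists_equiv_inv (hq0 : q ≠ 0) :
    ∃ e : CUq2 q ≃⋆ₐ[ℂ] CUq2 q⁻¹, e (D q) = star (D q⁻¹) := by
  have key : ∀ {p r : ℂ}, p ≠ 0 → p⁻¹ = r → ∃ φ : CUq2 r →⋆ₐ[ℂ] CUq2 p,
      φ (a r) = star (a p) ∧ φ (b r) = (‖p‖ : ℂ) • b p ∧ φ (D r) = star (D p) := by
    rintro p r hp rfl
    exact (existsUnique_hom (rel_inv hp)).exists
  obtain ⟨φ, hφa, hφb, hφD⟩ := key (inv_ne_zero hq0) (inv_inv q)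
  obtain ⟨ψ, hψa, hψb, hψD⟩ := key hq0 rfl
  have hb : ∀ {p r : ℂ} (φ : CUq2 p →⋆ₐ[ℂ] CUq2 r) (ψ : CUq2 r →⋆ₐ[ℂ] CUq2 p), p ≠ 0 → p⁻¹ = r →
      φ (b p) = (‖r‖ : ℂ) • b r → ψ (b r) = (‖p‖ : ℂ) • b p → ψ (φ (b p)) = b p := by
    rintro p r φ ψ hp rfl hφ hψ
    rw [hφ, map_smul, hψ, norm_inv, Complex.ofReal_inv,
      inv_smul_smul₀ (Complex.ofReal_ne_zero.2 (norm_ne_zero_iff.2 hp))]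
  have h1 : ψ.comp φ = StarAlgHom.id ℂ _ := hom_ext
    (show ψ (φ (a q)) = a q by rw [hφa, map_star, hψa, star_star])
    (hb φ ψ hq0 rfl hφb hψb)
    (show ψ (φ (D q)) = D q by rw [hφD, map_star, hψD, star_star])
  have h2 : φ.comp ψ = StarAlgHom.id ℂ _ := hom_ext
    (show φ (ψ (a q⁻¹)) = a q⁻¹ by rw [hψa, map_star, hφa, star_star])
    (hb ψ φ (inv_ne_zero hq0) (inv_inv q) hψb hφb)
    (show φ (ψ (D q⁻¹)) = D q⁻¹ by rw [hψD, map_star, hφD, star_star])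
  exact ⟨StarAlgEquiv.ofStarAlgHom φ ψ h1 h2, hφD⟩

theorem commute_map {p r : ℂ} (e : CUq2 p ≃⋆ₐ[ℂ] CUq2 r) {x : CUq2 p} (hx : ∀ y, Commute y x)
    (y : CUq2 r) : Commute y (e x) := by
  have h1 := (hx (e.symm y)).eq
  have h2 := congrArg e h1
  rwa [map_mul, map_mul, StarAlgEquiv.apply_symm_apply] at h2

theorem central_mem_elemental (hq0 : q ≠ 0) (hq1 : ‖q‖ ≠ 1) (hD : ∀ y, Commute y (D q))
    {x : CUq2 q} (hx : ∀ y, Commute y x) : x ∈ StarAlgebra.elemental ℂ (D q) := by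
  rcases hq1.lt_or_gt with hq | hq
  · exact central_mem_elemental_of_norm_lt hq0 hq hD hx
  · obtain ⟨e, he⟩ := exists_equiv_inv hq0
    have hD' : ∀ y, Commute y (D q⁻¹) := fun y => by
      have h1 := commute_map e hD (star y)
      rw [he] at h1
      exact commute_star_star.1 h1
    have h1 := central_mem_elemental_of_norm_lt (inv_ne_zero hq0)
      (by rw [norm_inv]; exact inv_lt_one_of_one_lt₀ hq) hD' (commute_map e hx)
    let S : StarSubalgebra ℂ (CUq2 q⁻¹) :=
      (StarAlgebra.elemental ℂ (D q)).comap (e.symm : CUq2 q⁻¹ →⋆ₐ[ℂ] CUq2 q)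
    have hc : Continuous e.symm := AddMonoidHomClass.continuous_of_bound e.symm 1 fun x => by
      simpa using NonUnitalStarAlgHom.norm_apply_le (e.symm : CUq2 q⁻¹ →⋆ₐ[ℂ] CUq2 q) x
    have hS : IsClosed (S : Set (CUq2 q⁻¹)) := (StarAlgebra.elemental.isClosed ℂ (D q)).preimage hc
    have h2 : D q⁻¹ ∈ S := by
      change e.symm (D q⁻¹) ∈ StarAlgebra.elemental ℂ (D q)
      have : e.symm (D q⁻¹) = star (D q) := by
        rw [← star_star (D q⁻¹), ← he, ← map_star, StarAlgEquiv.symm_apply_apply]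
      rw [this]
      exact StarAlgebra.elemental.star_self_mem ℂ _
    have h3 : e.symm (e x) ∈ StarAlgebra.elemental ℂ (D q) :=
      StarAlgebra.elemental.le_of_mem hS h2 h1
    rwa [StarAlgEquiv.symm_apply_apply] at h3

theorem central_mem_range (hq0 : q ≠ 0) (hq1 : ‖q‖ ≠ 1)
    (hω : ∀ n : ℤ, uqPhase q ^ n = 1 → n = 0) {x : CUq2 q} (hx : ∀ y, Commute y x) :
    x ∈ Set.range (algebraMap ℂ (CUq2 q)) := by
  rcases hq1.lt_or_gt with hq | hq
  · exact central_mem_range_of_norm_lt hq0 hq hω hx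
  · obtain ⟨e, -⟩ := exists_equiv_inv hq0
    obtain ⟨c, hc⟩ := central_mem_range_of_norm_lt (inv_ne_zero hq0)
      (by rw [norm_inv]; exact inv_lt_one_of_one_lt₀ hq)
      (fun n hn => hω n (by rwa [uqPhase_inv, inv_zpow, inv_eq_one] at hn)) (commute_map e hx)
    refine ⟨c, e.injective (Eq.trans ?_ hc)⟩
    change e (algebraMap ℂ (CUq2 q) c) = _
    rw [Algebra.algebraMap_eq_smul_one, Algebra.algebraMap_eq_smul_one, map_smul, map_one]

theorem commute_D (hω : uqPhase q = 1) (y : CUq2 q) : Commute y (D q) := by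
  have h := rel q
  have hb : Commute (b q) (D q) := by
    have := h.b_mul_D
    rwa [hω, one_smul] at this
  have hb' : Commute (star (b q)) (D q) := by
    have := h.star_b_mul_D
    rwa [hω, star_one, one_smul] at this
  have ha' : Commute (star (a q)) (D q) := commute_star_comm.2 h.commute_a_star_D
  have hD' : Commute (star (D q)) (D q) := h.sD_D.trans h.D_sD.symm
  exact mem_of_word_mem (M := LinearMap.eqLocus
      ((ContinuousLinearMap.mul ℂ (CUq2 q)).flip (D q)).toLinearMap
      (ContinuousLinearMap.mul ℂ (CUq2 q) (D q)).toLinearMap)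
    (isClosed_eq (ContinuousLinearMap.continuous _) (ContinuousLinearMap.continuous _))
    (fun _ _ _ _ hw => hw.commute h.aD ha' hb hb' (Commute.refl _) hD') y

theorem spectrum_D (q : ℂ) : spectrum ℂ (D q) = Metric.sphere (0 : ℂ) 1 := by
  refine Set.Subset.antisymm ?_ fun z hz => ?_
  · exact spectrum.subset_circle_of_unitary (show D q ∈ unitary (CUq2 q) from (rel q).unitaryD.2)
  · have hz1 : ‖z‖ = 1 := by simpa using hz
    obtain ⟨φ, -, -, hφ⟩ := exists_character q (u := 1) (v := z) (by simp)
      (by rw [Complex.star_def, Complex.mul_conj', hz1]; norm_num)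
    rw [← hφ]
    exact AlgHom.apply_mem_spectrum φ.toAlgHom (D q)

instance isStarNormal_D : IsStarNormal (D q) := ⟨(rel q).sD_D.trans (rel q).D_sD.symm⟩

end CUq2

/-! ### The phase for real `q` and for irrational angles -/

theorem uqPhase_eq_one {q : ℂ} (hq0 : q ≠ 0) (hq : q.im = 0) : uqPhase q = 1 := by
  obtain ⟨x, rfl⟩ : ∃ x : ℝ, (x : ℂ) = q := ⟨q.re, Complex.ext rfl hq.symm⟩
  have hx : x ≠ 0 := Complex.ofReal_ne_zero.1 hq0
  rw [uqPhase, Complex.norm_real, zpow_neg, zpow_ofNat, ← Complex.ofReal_pow, ← Complex.ofReal_pow,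
    Real.norm_eq_abs, sq_abs, ← Complex.ofReal_inv, ← Complex.ofReal_mul,
    mul_inv_cancel₀ (pow_ne_zero 2 hx), Complex.ofReal_one]

theorem eq_zero_of_uqPhase_zpow_eq_one {q : ℂ} (hq0 : q ≠ 0)
    (hq : Irrational (q.arg / Real.pi)) (n : ℤ) (hn : uqPhase q ^ n = 1) : n = 0 := by
  have hq' : (‖q‖ : ℂ) ≠ 0 := Complex.ofReal_ne_zero.2 (norm_ne_zero_iff.2 hq0)
  have h1 : uqPhase q = Complex.exp (2 * (q.arg * Complex.I)) := by
    have h2 : q ^ 2 = ((‖q‖ : ℂ) * Complex.exp (q.arg * Complex.I)) ^ 2 := by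
      rw [Complex.norm_mul_exp_arg_mul_I]
    rw [uqPhase, h2, mul_pow, ← Complex.exp_nat_mul, mul_right_comm, zpow_neg,
      zpow_ofNat, mul_inv_cancel₀ (pow_ne_zero 2 hq'), one_mul, Nat.cast_ofNat]
  rw [h1, ← Complex.exp_int_mul, Complex.exp_eq_one_iff] at hn
  obtain ⟨m, hm⟩ := hn
  have h2 : (n : ℝ) * q.arg = m * Real.pi := by
    have h3 : ((n * q.arg : ℝ) : ℂ) * (2 * Complex.I) = ((m * Real.pi : ℝ) : ℂ) * (2 * Complex.I) := by
      push_cast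
      linear_combination hm
    exact Complex.ofReal_injective
      (mul_right_cancel₀ (mul_ne_zero two_ne_zero Complex.I_ne_zero) h3)
  by_contra hn0
  refine hq ⟨m / n, ?_⟩
  have hn1 : (n : ℝ) ≠ 0 := Int.cast_ne_zero.2 hn0
  push_cast
  rw [div_eq_div_iff hn1 Real.pi_ne_zero, ← h2, mul_comm]

/-! ### Identification of the center -/

namespace CUq2

theorem mem_center_iff_commute {q : ℂ} {x : CUq2 q} :
    x ∈ NonUnitalStarSubalgebra.center ℂ (CUq2 q) ↔ ∀ y, Commute y x :=
  NonUnitalStarSubalgebra.mem_center_iff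

/-- If `q` is real, then the center is the C*-algebra generated by `D`. -/
theorem coe_center_eq_elemental {q : ℂ} (hq0 : q ≠ 0) (hq1 : ‖q‖ ≠ 1) (hq : q.im = 0) :
    (NonUnitalStarSubalgebra.center ℂ (CUq2 q) : Set (CUq2 q)) =
      StarAlgebra.elemental ℂ (D q) := by
  have hD := commute_D (uqPhase_eq_one hq0 hq)
  refine Set.Subset.antisymm (fun x hx => central_mem_elemental hq0 hq1 hD
    (mem_center_iff_commute.1 hx)) fun x hx => ?_
  have h1 : StarAlgebra.elemental ℂ (D q) ≤ StarSubalgebra.centralizer ℂ (Set.univ) :=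
    StarAlgebra.elemental.le_of_mem (by
      rw [StarSubalgebra.coe_centralizer]; exact Set.isClosed_centralizer _)
      (StarSubalgebra.mem_centralizer_iff ℂ |>.2 fun y _ => ⟨hD y, hD (star y)⟩)
  exact mem_center_iff_commute.2 fun y =>
    ((StarSubalgebra.mem_centralizer_iff ℂ).1 (h1 hx) y (Set.mem_univ y)).1

end CUq2

theorem theorem3p2 (q : ℂ) (hq0 : q ≠ 0) (hq1 : ‖q‖ ≠ 1) :
    (q.im = 0 →
      Nonempty (NonUnitalStarSubalgebra.center ℂ (CUq2 q) ≃⋆ₐ[ℂ] C(Circle, ℂ))) ∧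
    (q.im ≠ 0 → Irrational (q.arg / Real.pi) →
      (NonUnitalStarSubalgebra.center ℂ (CUq2 q) : Set (CUq2 q)) =
          Set.range (algebraMap ℂ (CUq2 q)) ∧
        Nonempty (NonUnitalStarSubalgebra.center ℂ (CUq2 q) ≃⋆ₐ[ℂ] ℂ)) := by
  refine ⟨fun hq => ?_, fun _ hq => ?_⟩
  · have hC := Set.ext_iff.1 (CUq2.coe_center_eq_elemental hq0 hq1 hq)
    let e₁ : NonUnitalStarSubalgebra.center ℂ (CUq2 q) ≃⋆ₐ[ℂ]
        StarAlgebra.elemental ℂ (CUq2.D q) :=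
      { toFun := fun x => ⟨x.1, (hC _).1 x.2⟩
        invFun := fun x => ⟨x.1, (hC _).2 x.2⟩
        left_inv := fun _ => rfl
        right_inv := fun _ => rfl
        map_mul' := fun _ _ => rfl
        map_add' := fun _ _ => rfl
        map_star' := fun _ => rfl
        map_smul' := fun _ _ => rfl }
    let e₂ : Circle ≃ₜ spectrum ℂ (CUq2.D q) :=
      (Homeomorph.setCongr (CUq2.spectrum_D q)).symm
    exact ⟨e₁.trans ((continuousFunctionalCalculus (CUq2.D q)).symm.trans
      (e₂.compStarAlgEquiv' ℂ ℂ))⟩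
  · have hC : (NonUnitalStarSubalgebra.center ℂ (CUq2 q) : Set (CUq2 q)) =
        Set.range (algebraMap ℂ (CUq2 q)) := by
      refine Set.Subset.antisymm (fun x hx => CUq2.central_mem_range hq0 hq1
        (eq_zero_of_uqPhase_zpow_eq_one hq0 hq) (CUq2.mem_center_iff_commute.1 hx)) ?_
      rintro _ ⟨c, rfl⟩
      exact CUq2.mem_center_iff_commute.2 fun y => (Algebra.commutes c y).symm
    obtain ⟨φ, -⟩ := CUq2.exists_character q (u := 1) (v := 1) (by simp) (by simp)
    have : Nontrivial (CUq2 q) := φ.toRingHom.domain_nontrivial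
    refine ⟨hC, ⟨StarAlgEquiv.symm
      { Equiv.ofBijective
          (fun c : ℂ => (⟨algebraMap ℂ (CUq2 q) c, hC.ge ⟨c, rfl⟩⟩ :
            NonUnitalStarSubalgebra.center ℂ (CUq2 q)))
          ⟨fun c d h => (algebraMap ℂ (CUq2 q)).injective (congrArg Subtype.val h), fun x => by
            obtain ⟨c, hc⟩ := hC.le x.2
            exact ⟨c, Subtype.ext hc⟩⟩ with
        map_mul' := fun c d => Subtype.ext (map_mul _ c d)
        map_add' := fun c d => Subtype.ext (map_add _ c d)
        map_star' := fun c => Subtype.ext (algebraMap_star_comm c)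
        map_smul' := fun c d => Subtype.ext (by
          change algebraMap ℂ (CUq2 q) (c * d) = c • algebraMap ℂ (CUq2 q) d
          rw [map_mul, Algebra.smul_def]) }⟩⟩
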